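/- \textbf{Conventions.} An alphabet is a finite set $A$. For words $u,v\in A^*$, $\mathrm{Mon}\langle A\mid u=v\rangle$ is the quotient of the free monoid $A^*$ by the congruence generated by $(u,v)$; such a monoid is called a \emph{one-relation monoid}. Let $A^{-1}$ be a disjoint copy of $A$, and for a word $x$ over $A\cup A^{-1}$ let $x^{-1}$ be its formal inverse (reverse the word and invert every letter). For a word $w$ over $A\cup A^{-1}$, the special one-relator inverse monoid $\mathrm{Inv}\langle A\mid w=1\rangle$ is the quotient of $(A\cup A^{-1})^*$ by the congruence generated by $w=1$ together with $xx^{-1}x=x$ and $xx^{-1}yy^{-1}=yy^{-1}xx^{-1}$ for all words $x,y$ over $A\cup A^{-1}$. The word $w$ is \emph{reduced} if it has no subword $aa^{-1}$ or $a^{-1}a$ with $a\in A$. The word problem for a presented monoid is decidable if there is an algorithm which, given two words over the generators ($A$, respectively $A\cup A^{-1}$), decides whether they are equal in the monoid. \textbf{Theorem.} \begin{enumerate} \item If for every alphabet $A$ and every reduced word $w$ over $A\cup A^{-1}$ the word problem for $\mathrm{Inv}\langle A\mid w=1\rangle$ is decidable, then the word problem is decidable for every one-relation monoid $\mathrm{Mon}\langle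 A\mid u=v\rangle$. \item If $p,q\in A^*$ and the monoid $\mathrm{Mon}\langle A\mid p=q\rangle$ is right cancellative, then the identity map on $A$ extends to an injective homomorphism $\mathrm{Mon}\langle A\mid p=q\rangle\to\mathrm{Inv}\langle A\mid pq^{-1}=1\rangle$. \item For all $u,v\in\{a,b\}^*$ the monoid $\mathrm{Mon}\langle a,b\mid aub=ava\rangle$ is right cancellative, and the identity map on $\{a,b\}$ extends to an injective homomorphism from it to $\mathrm{Inv}\langle a,b\mid aub(ava)^{-1}=1\rangle$. \item For every $u\in\{a,b\}^*$ the monadic monoid $\mathrm{Mon}\langle a,b\mid aub=a\rangle$ is right cancellative, and the identity map on $\{a,b\}$ extends to an injective homomorphism from it to $\mathrm{Inv}\langle a,b\mid auba^{-1}=1\rangle$. \end{enumerate} -/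

import Mathlib

/-- The relation on words over `A` with the single defining relation `u = v`. Thus
`PresentedMonoid (MonRel u v)` is the one-relation monoid `Mon⟨A | u = v⟩`. -/
inductive MonRel {A : Type*} (u v : List A) : FreeMonoid A → FreeMonoid A → Prop
  | rel : MonRel u v (FreeMonoid.ofList u) (FreeMonoid.ofList v)

/-- The defining relations of the special one-relator inverse monoid `Inv⟨A | w = 1⟩`, as relations
on words over `A ∪ A⁻¹`. A letter `a` is `(a, true)` and its formal inverse `a⁻¹` is `(a, false)`;
`FreeGroup.invRev` is the formal inverse `(x₁ ⋯ xₖ)⁻¹ = xₖ⁻¹ ⋯ x₁⁻¹` of a word.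
`inv_mul` and `comm` are Vagner's relations `x x⁻¹ x = x` and `x x⁻¹ y y⁻¹ = y y⁻¹ x x⁻¹` for
arbitrary words `x`, `y`, which define the free inverse monoid on `A`; `rel` is `w = 1`. -/
inductive InvRel {A : Type*} (w : List (A × Bool)) :
    FreeMonoid (A × Bool) → FreeMonoid (A × Bool) → Prop
  | inv_mul (x : List (A × Bool)) :
      InvRel w (FreeMonoid.ofList (x ++ FreeGroup.invRev x ++ x)) (FreeMonoid.ofList x)
  | comm (x y : List (A × Bool)) :
      InvRel w
        (FreeMonoid.ofList (x ++ FreeGroup.invRev x ++ (y ++ FreeGroup.invRev y)))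
        (FreeMonoid.ofList (y ++ FreeGroup.invRev y ++ (x ++ FreeGroup.invRev x)))
  | rel : InvRel w (FreeMonoid.ofList w) 1

/-- The one-relation monoid `Mon⟨A | u = v⟩`. -/
abbrev OneRelMonoid {A : Type*} (u v : List A) : Type _ :=
  PresentedMonoid (MonRel u v)

/-- The special one-relator inverse monoid `Inv⟨A | w = 1⟩`. -/
abbrev SpecialInvMonoid {A : Type*} (w : List (A × Bool)) : Type _ :=
  PresentedMonoid (InvRel w)

/-- The word problem for the monoid presented by the alphabet `A` and the relations `R` is
decidable: some algorithm decides, given two words over `A`, whether they are equal in the monoid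
(the monoid being fixed). -/
def WordProblemDecidable {A : Type*} [Primcodable A]
    (R : FreeMonoid A → FreeMonoid A → Prop) : Prop :=
  ComputablePred fun p : List A × List A =>
    PresentedMonoid.mk R (FreeMonoid.ofList p.1) = PresentedMonoid.mk R (FreeMonoid.ofList p.2)

/-- A word over `A`, viewed as a word over `A ∪ A⁻¹`. -/
def positiveWord {A : Type*} (u : List A) : List (A × Bool) :=
  u.map fun a => (a, true)

/-- The word `p q⁻¹` over `A ∪ A⁻¹`, for words `p`, `q` over `A`. -/
def quotientWord {A : Type*} (p q : List A) : List (A × Bool) :=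
  positiveWord p ++ FreeGroup.invRev (positiveWord q)

/-- The identity map of the alphabet `A` extends to an injective monoid homomorphism
`Mon⟨A | p = q⟩ → Inv⟨A | p q⁻¹ = 1⟩`. -/
def NaturallyEmbeds {A : Type*} (p q : List A) : Prop :=
  ∃ f : OneRelMonoid p q →* SpecialInvMonoid (quotientWord p q),
    (∀ a : A, f (PresentedMonoid.of (MonRel p q) a) =
      PresentedMonoid.of (InvRel (quotientWord p q)) (a, true)) ∧
    Function.Injective f

/-!
One-relation monoids and special one-relator inverse monoids.

*Right cancellation.* If `u` and `v` end in different letters, a derivation `x c ⇒ y c` that touches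
its right end does so in pairs of mutually inverse steps, and deleting a pair shortens it
(`Derives.cancel`). Hence `Mon⟨A | u = v⟩` is right cancellative (`isRightCancelMul_of_last_ne`).

*Embedding.* If `M = Mon⟨A | p = q⟩` is right cancellative, right multiplications are partial
bijections of `M`, and `p q⁻¹` acts as the identity. So `Inv⟨A | p q⁻¹ = 1⟩` acts on `M`, and the
natural homomorphism is injective because `M` acts faithfully on itself
(`naturallyEmbeds_of_isRightCancelMul`).

*Word problem.* If the word problem is decidable for all `Inv⟨A | w = 1⟩` with `w` reduced, the two
facts above solve it for all `Mon⟨A | u = v⟩` with `u`, `v` ending in different letters, as `u v⁻¹`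
is then reduced, and by reversal for those beginning with different letters. A relation whose sides
have the first letter `a` and the last letter `b` in common is compressed to a shorter one over the
infinite alphabet of all words: if `a ≠ b`, words are cut before each `a` and after each `b`
(`exists_compression_of_ne`); if `a = b`, they are split at the occurrences of `a`
(`exists_compression_of_eq`). All alphabets are coded in `ℕ`, and the coding `natCode` returns to
finite alphabets. Induction on the length leaves the special monoids `Mon⟨A | u = 1⟩`.

*Special monoids.* The words that represent units form a free monoid, whose basis consists of the
words with no proper nonempty prefix representing a unit. Writing `u` as a product of basis words
and naming their values by letters gives a relator `r` over an alphabet `ι`. Evaluation of products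
of basis words in `Mon⟨ι | r = 1⟩` is invariant under insertion and deletion of `u`
(`PieceLabels.Eval.of_word_eq`), so that `Mon⟨ι | r = 1⟩` is embedded in the units of
`Mon⟨A | u = 1⟩`. It is therefore right cancellative, and its word problem is decidable because `r`
is a positive, hence reduced, word. Replacing products of short basis words by smaller equal ones
is a terminating and confluent rewriting system for `Mon⟨A | u = 1⟩` (`join_of_rewrites`,
`IsNormal.eq_of_word_eq`). Whether a word is in normal form is a question about finitely many
equations in `Mon⟨ι | r = 1⟩`, so that normal forms can be found by search
(`wordProblemDecidable_special`).
-/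

namespace OneRel

/-! ### Derivations over a one-relation monoid -/

section

variable {A : Type*}

/-- The element of `Mon⟨A | u = v⟩` represented by a word. -/
def word (u v w : List A) : OneRelMonoid u v :=
  PresentedMonoid.mk (MonRel u v) (FreeMonoid.ofList w)

variable {u v : List A}

@[simp] lemma word_nil : word u v [] = 1 := rfl

lemma word_append (x y : List A) : word u v (x ++ y) = word u v x * word u v y :=
  (PresentedMonoid.mk (MonRel u v)).map_mul (FreeMonoid.ofList x) (FreeMonoid.ofList y)

lemma word_cons (a : A) (x : List A) : word u v (a :: x) = word u v [a] * word u v x :=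
  word_append [a] x

lemma word_rel : word u v u = word u v v := PresentedMonoid.mk_eq_mk_of_rel MonRel.rel

lemma word_surjective (m : OneRelMonoid u v) : ∃ w, word u v w = m := by
  obtain ⟨w, rfl⟩ := PresentedMonoid.surjective_mk m
  exact ⟨FreeMonoid.toList w, rfl⟩

lemma lift_word {M : Type*} [Monoid M] (f : A → M)
    (h : ∀ a b, MonRel u v a b → FreeMonoid.lift f a = FreeMonoid.lift f b) (w : List A) :
    PresentedMonoid.lift f h (word u v w) = (w.map f).prod := by
  change FreeMonoid.lift f (FreeMonoid.ofList w) = _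
  simp [FreeMonoid.lift_apply]

/-- A single application of the relation `u = v` inside a word, in either direction. -/
inductive Step (u v : List A) : List A → List A → Prop
  | mp (x y : List A) : Step u v (x ++ u ++ y) (x ++ v ++ y)
  | mpr (x y : List A) : Step u v (x ++ v ++ y) (x ++ u ++ y)

lemma Step.symm {w w' : List A} (h : Step u v w w') : Step u v w' w := by
  cases h with
  | mp x y => exact .mpr x y
  | mpr x y => exact .mp x y

instance : Std.Symm (Step u v) := ⟨fun _ _ => Step.symm⟩

lemma Step.context {w w' : List A} (h : Step u v w w') (x y : List A) :
    Step u v (x ++ w ++ y) (x ++ w' ++ y) := by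
  cases h with
  | mp a b => simpa using Step.mp (u := u) (v := v) (x ++ a) (b ++ y)
  | mpr a b => simpa using Step.mpr (u := u) (v := v) (x ++ a) (b ++ y)

lemma Step.word_eq {w w' : List A} (h : Step u v w w') : word u v w = word u v w' := by
  cases h <;> simp only [word_append, word_rel (u := u) (v := v)]

open Relation in
lemma word_eq_iff {w w' : List A} :
    word u v w = word u v w' ↔ ReflTransGen (Step u v) w w' := by
  constructor
  · intro h
    have h' := PresentedMonoid.mk_eq_mk_iff.1 h
    have key : ∀ a b : FreeMonoid A, ConGen.Rel (MonRel u v) a b →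
        ReflTransGen (Step u v) (FreeMonoid.toList a) (FreeMonoid.toList b) := by
      intro a b hab
      induction hab with
      | of a b h =>
        cases h
        simpa using ReflTransGen.single (Step.mp (u := u) (v := v) [] [])
      | refl => exact .refl
      | symm _ ih => exact symm ih
      | trans _ _ ih₁ ih₂ => exact ih₁.trans ih₂
      | mul _ _ ih₁ ih₂ =>
        rename_i a b c d _ _
        simp only [FreeMonoid.toList_mul]
        refine ReflTransGen.trans (b := FreeMonoid.toList b ++ FreeMonoid.toList c) ?_ ?_
        · refine ReflTransGen.lift (fun z => z ++ FreeMonoid.toList c) (fun x y h => ?_) _ _ ih₁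
          simpa using h.context [] (FreeMonoid.toList c)
        · refine ReflTransGen.lift (fun z => FreeMonoid.toList b ++ z) (fun x y h => ?_) _ _ ih₂
          simpa using h.context (FreeMonoid.toList b) []
    exact key _ _ h'
  · intro h
    induction h with
    | refl => rfl
    | tail _ h ih => exact ih.trans h.word_eq

/-- A property of words that is preserved by inserting the relation in both directions depends
only on the element represented. -/
lemma word_induction {P : List A → Prop} (h₁ : ∀ x y, P (x ++ u ++ y) → P (x ++ v ++ y))
    (h₂ : ∀ x y, P (x ++ v ++ y) → P (x ++ u ++ y)) {w w' : List A}
    (h : word u v w = word u v w') (hw : P w) : P w' := by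
  rw [word_eq_iff] at h
  induction h with
  | refl => exact hw
  | tail _ h ih =>
    cases h with
    | mp x y => exact h₁ x y ih
    | mpr x y => exact h₂ x y ih

/-- If the letters act on the right of a set `σ` so that `u` and `v` act equally on the states
satisfying an invariant, then words that are equal in `Mon⟨A | u = v⟩` act equally. -/
lemma foldl_eq_of_word_eq {σ : Type*} (step : σ → A → σ) (I : σ → Prop)
    (hI : ∀ x a, I x → I (step x a)) (huv : ∀ x, I x → u.foldl step x = v.foldl step x)
    {w w' : List A} (h : word u v w = word u v w') {x : σ} (hx : I x) :
    w.foldl step x = w'.foldl step x := by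
  have hI' : ∀ (l : List A) (x : σ), I x → I (l.foldl step x) := by
    intro l
    induction l with
    | nil => exact fun x hx => hx
    | cons a l ih => exact fun x hx => ih _ (hI _ _ hx)
  refine word_induction (P := fun z => w.foldl step x = z.foldl step x) ?_ ?_ h rfl
  · intro y z hy
    rw [hy]
    simp [List.foldl_append, huv _ (hI' y x hx)]
  · intro y z hy
    rw [hy]
    simp [List.foldl_append, huv _ (hI' y x hx)]

/-- Substituting words for letters respects the relations as soon as it respects `u = v`. -/
lemma word_flatMap_eq {B : Type*} {u' v' : List B} (f : A → List B)
    (huv : word u' v' (u.flatMap f) = word u' v' (v.flatMap f)) {w w' : List A}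
    (h : word u v w = word u v w') : word u' v' (w.flatMap f) = word u' v' (w'.flatMap f) := by
  refine word_induction (P := fun z => word u' v' (w.flatMap f) = word u' v' (z.flatMap f))
    ?_ ?_ h rfl
  · intro x y hxy
    rw [hxy]
    simp only [List.flatMap_append, word_append, huv]
  · intro x y hxy
    rw [hxy]
    simp only [List.flatMap_append, word_append, huv]

/-! ### Right cancellation when the last letters differ -/

/-- Derivations of a given length. -/
inductive Derives (u v : List A) : ℕ → List A → List A → Prop
  | refl (w : List A) : Derives u v 0 w w
  | head {n : ℕ} {w₁ w₂ w₃ : List A} :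
      Step u v w₁ w₂ → Derives u v n w₂ w₃ → Derives u v (n + 1) w₁ w₃

lemma Derives.trans {m n : ℕ} {w₁ w₂ w₃ : List A} (h₁ : Derives u v m w₁ w₂)
    (h₂ : Derives u v n w₂ w₃) : Derives u v (m + n) w₁ w₃ := by
  induction h₁ with
  | refl => simpa using h₂
  | head h _ ih => rw [Nat.add_right_comm]; exact .head h (ih h₂)

lemma Derives.append_right {n : ℕ} {w w' : List A} (h : Derives u v n w w') (z : List A) :
    Derives u v n (w ++ z) (w' ++ z) := by
  induction h with
  | refl => exact .refl _
  | head h _ ih => exact .head (by simpa using h.context [] z) ih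

lemma Derives.word_eq {n : ℕ} {w w' : List A} (h : Derives u v n w w') :
    word u v w = word u v w' := by
  induction h with
  | refl => rfl
  | head h _ ih => exact h.word_eq.trans ih

lemma exists_derives {w w' : List A} (h : word u v w = word u v w') :
    ∃ n, Derives u v n w w' := by
  rw [word_eq_iff] at h
  induction h using Relation.ReflTransGen.head_induction_on with
  | refl => exact ⟨0, .refl _⟩
  | head h _ ih => obtain ⟨n, hn⟩ := ih; exact ⟨n + 1, .head h hn⟩

/-- A derivation between nonempty words either never touches the last letter, or
has a first step that replaces a suffix. -/
lemma Derives.split {n : ℕ} {x y : List A} {c d : A}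
    (h : Derives u v n (x ++ [c]) (y ++ [d])) :
    (c = d ∧ Derives u v n x y) ∨
    ∃ i j z l p q, i + 1 + j = n ∧ Derives u v i x z ∧ (p = u ∧ q = v ∨ p = v ∧ q = u) ∧
      z ++ [c] = l ++ p ∧ Derives u v j (l ++ q) (y ++ [d]) := by
  generalize hw : x ++ [c] = w at h
  generalize hw' : y ++ [d] = w' at h
  induction h generalizing x with
  | refl w =>
    have := hw.trans hw'.symm
    rw [List.append_singleton_inj] at this
    obtain ⟨rfl, rfl⟩ := this
    exact .inl ⟨rfl, .refl _⟩
  | @head n w₁ w₂ w₃ hs hd ih =>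
    have main : ∀ l r p q : List A, w₁ = l ++ p ++ r → w₂ = l ++ q ++ r →
        (p = u ∧ q = v ∨ p = v ∧ q = u) → (∀ r', Step u v (l ++ p ++ r') (l ++ q ++ r')) →
        (c = d ∧ Derives u v (n + 1) x y) ∨
        ∃ i j z l p q, i + 1 + j = n + 1 ∧ Derives u v i x z ∧
          (p = u ∧ q = v ∨ p = v ∧ q = u) ∧ z ++ [c] = l ++ p ∧ Derives u v j (l ++ q) w₃ := by
      intro l r p q h₁ h₂ hpq hst
      rcases List.eq_nil_or_concat' r with rfl | ⟨r', e, rfl⟩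
      · refine .inr ⟨0, n, x, l, p, q, by omega, .refl _, hpq, by simpa using hw.trans h₁, ?_⟩
        rwa [h₂, List.append_nil] at hd
      · rw [h₁, ← List.append_assoc, List.append_singleton_inj] at hw
        obtain ⟨rfl, rfl⟩ := hw
        rcases ih (x := l ++ q ++ r') (by simp [h₂]) hw' with ⟨hcd, hn⟩ | ⟨i, j, z, l', p', q', hij, hi, h⟩
        · exact .inl ⟨hcd, .head (hst r') hn⟩
        · exact .inr ⟨i + 1, j, z, l', p', q', by omega, .head (hst r') hi, h⟩
    subst hw'
    cases hs with
    | mp l r => exact main l r u v rfl rfl (.inl ⟨rfl, rfl⟩) fun r' => .mp l r'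
    | mpr l r => exact main l r v u rfl rfl (.inr ⟨rfl, rfl⟩) fun r' => .mpr l r'

/-- If `u` and `v` end in different letters, then a derivation `x c ⇒ y c` can be shortened to a
derivation `x ⇒ y`: two consecutive steps at the right end are mutually inverse, and deleting
them shortens the derivation. -/
lemma Derives.cancel {u₀ v₀ : List A} {a b : A} (hab : a ≠ b) (n : ℕ) {x y : List A} {c : A}
    (h : Derives (u₀ ++ [a]) (v₀ ++ [b]) n (x ++ [c]) (y ++ [c])) :
    ∃ m ≤ n, Derives (u₀ ++ [a]) (v₀ ++ [b]) m x y := by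
  induction n using Nat.strong_induction_on generalizing x y c with
  | _ n ih =>
    have ihl : ∀ (k : ℕ) (_ : k < n) (s x y : List A),
        Derives (u₀ ++ [a]) (v₀ ++ [b]) k (x ++ s) (y ++ s) →
        ∃ m ≤ k, Derives (u₀ ++ [a]) (v₀ ++ [b]) m x y := by
      intro k hk s
      induction s using List.reverseRecOn generalizing k with
      | nil => exact fun x y h => ⟨k, le_rfl, by simpa using h⟩
      | append_singleton s e ihs =>
        intro x y h
        obtain ⟨m, hm, h'⟩ := ih k hk (x := x ++ s) (y := y ++ s) (c := e) (by simpa using h)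
        obtain ⟨m', hm', h''⟩ := ihs m (by omega) x y h'
        exact ⟨m', by omega, h''⟩
    rcases h.split with ⟨-, h⟩ | ⟨i, j, z, l, p, q, hij, hi, hpq, hz, hj⟩
    · exact ⟨n, le_rfl, h⟩
    -- The first step at the right end turns `p` into `q`; the next one must turn `q` into `p`.
    have main : ∀ (p₀ q₀ : List A) (e f : A), p = p₀ ++ [e] → q = q₀ ++ [f] → e ≠ f →
        (∀ p' q', (p' = u₀ ++ [a] ∧ q' = v₀ ++ [b] ∨ p' = v₀ ++ [b] ∧ q' = u₀ ++ [a]) →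
          p' = p ∧ q' = q ∨ p' = q ∧ q' = p) →
        ∃ m ≤ n, Derives (u₀ ++ [a]) (v₀ ++ [b]) m x y := by
      rintro p₀ q₀ e f rfl rfl hef hor
      rw [← List.append_assoc, List.append_singleton_inj] at hz
      obtain ⟨rfl, rfl⟩ := hz
      rw [← List.append_assoc] at hj
      rcases hj.split with ⟨hc, -⟩ | ⟨i', j', z', l', p', q', hij', hi', hpq', hz', hj'⟩
      · exact absurd hc.symm hef
      rcases hor p' q' hpq' with ⟨rfl, rfl⟩ | ⟨rfl, rfl⟩
      · rw [← List.append_assoc, List.append_singleton_inj] at hz'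
        exact absurd hz'.2.symm hef
      · rw [← List.append_assoc, List.append_singleton_inj] at hz'
        obtain ⟨rfl, -⟩ := hz'
        obtain ⟨k, hk, hl⟩ := ihl i' (by omega) q₀ l l' hi'
        have h₂ := (hi.append_right [c]).trans
          (Derives.trans (by simpa using hl.append_right (p₀ ++ [c])) hj')
        obtain ⟨m, hm, h₃⟩ := ih (i + (k + j')) (by omega) h₂
        exact ⟨m, by omega, h₃⟩
    rcases hpq with ⟨hp, hq⟩ | ⟨hp, hq⟩
    · refine main _ _ _ _ hp hq hab ?_
      rintro p' q' (⟨rfl, rfl⟩ | ⟨rfl, rfl⟩) <;> simp [hp, hq]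
    · refine main _ _ _ _ hp hq hab.symm ?_
      rintro p' q' (⟨rfl, rfl⟩ | ⟨rfl, rfl⟩) <;> simp [hp, hq]

/-- Adian's criterion: a one-relation monoid is right cancellative if the two sides of its
relation end in different letters. -/
theorem isRightCancelMul_of_last_ne (u₀ v₀ : List A) {a b : A} (hab : a ≠ b) :
    IsRightCancelMul (OneRelMonoid (u₀ ++ [a]) (v₀ ++ [b])) := by
  have key : ∀ s x y : List A, word (u₀ ++ [a]) (v₀ ++ [b]) (x ++ s) =
      word (u₀ ++ [a]) (v₀ ++ [b]) (y ++ s) →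
      word (u₀ ++ [a]) (v₀ ++ [b]) x = word (u₀ ++ [a]) (v₀ ++ [b]) y := by
    intro s
    induction s using List.reverseRecOn with
    | nil => exact fun x y h => by simpa using h
    | append_singleton s e ih =>
      intro x y h
      obtain ⟨n, hn⟩ := exists_derives h
      rw [← List.append_assoc, ← List.append_assoc] at hn
      obtain ⟨m, -, hm⟩ := hn.cancel hab
      exact ih x y hm.word_eq
  refine ⟨fun s x y h => ?_⟩
  obtain ⟨s, rfl⟩ := word_surjective s
  obtain ⟨x, rfl⟩ := word_surjective x
  obtain ⟨y, rfl⟩ := word_surjective y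
  simp only [← word_append] at h
  exact key s x y h

end

/-! ### The embedding into the special inverse monoid -/

section

variable {A : Type*}

/-- The element of `Inv⟨A | w = 1⟩` represented by a word over `A ∪ A⁻¹`. -/
def invWord (w x : List (A × Bool)) : SpecialInvMonoid w :=
  PresentedMonoid.mk (InvRel w) (FreeMonoid.ofList x)

lemma invWord_append (w x y : List (A × Bool)) :
    invWord w (x ++ y) = invWord w x * invWord w y :=
  (PresentedMonoid.mk (InvRel w)).map_mul (FreeMonoid.ofList x) (FreeMonoid.ofList y)

lemma invWord_self (w : List (A × Bool)) : invWord w w = 1 :=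
  PresentedMonoid.mk_eq_mk_of_rel InvRel.rel

lemma invRev_append (x y : List (A × Bool)) :
    FreeGroup.invRev (x ++ y) = FreeGroup.invRev y ++ FreeGroup.invRev x := by
  simp [FreeGroup.invRev]

/-- In `Inv⟨A | p q⁻¹ = 1⟩` the words `p` and `q` are equal: with `p q⁻¹ = 1 = q p⁻¹`,
`p = q p⁻¹ p = p q⁻¹ q p⁻¹ p = p p⁻¹ p q⁻¹ q = p q⁻¹ q = q`. -/
lemma invWord_positiveWord_eq (p q : List A) :
    invWord (quotientWord p q) (positiveWord p) = invWord (quotientWord p q) (positiveWord q) := by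
  set w := quotientWord p q with hw
  set P := positiveWord p
  set Q := positiveWord q
  have inv_mul (x : List (A × Bool)) :
      invWord w x * invWord w (FreeGroup.invRev x) * invWord w x = invWord w x := by
    simp only [← invWord_append]
    exact PresentedMonoid.mk_eq_mk_of_rel (InvRel.inv_mul x)
  have comm (x y : List (A × Bool)) :
      invWord w x * invWord w (FreeGroup.invRev x) *
        (invWord w y * invWord w (FreeGroup.invRev y)) =
      invWord w y * invWord w (FreeGroup.invRev y) *
        (invWord w x * invWord w (FreeGroup.invRev x)) := by
    simp only [← invWord_append]
    exact PresentedMonoid.mk_eq_mk_of_rel (InvRel.comm x y)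
  have h₁ : invWord w P * invWord w (FreeGroup.invRev Q) = 1 := by
    rw [← invWord_append]; exact invWord_self w
  have h₂ : invWord w Q * invWord w (FreeGroup.invRev P) = 1 := by
    have h := inv_mul (FreeGroup.invRev w)
    rw [FreeGroup.invRev_invRev, invWord_self, mul_one] at h
    have h' := inv_mul w
    rw [invWord_self, one_mul, mul_one] at h'
    rw [← invWord_append, ← h', hw, quotientWord, invRev_append, FreeGroup.invRev_invRev]
  have hP := inv_mul P
  have hc := comm (FreeGroup.invRev Q) (FreeGroup.invRev P)
  rw [FreeGroup.invRev_invRev, FreeGroup.invRev_invRev] at hc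
  calc invWord w P
      = invWord w P * invWord w (FreeGroup.invRev Q) *
          (invWord w Q * invWord w (FreeGroup.invRev P)) * invWord w P := by simp [h₁, h₂]
    _ = invWord w P * (invWord w (FreeGroup.invRev Q) * invWord w Q *
          (invWord w (FreeGroup.invRev P) * invWord w P)) := by simp only [mul_assoc]
    _ = invWord w P * invWord w (FreeGroup.invRev P) * invWord w P *
          invWord w (FreeGroup.invRev Q) * invWord w Q := by rw [hc]; simp only [mul_assoc]
    _ = invWord w Q := by rw [hP, h₁, one_mul]

/-- The partial bijections of a set, composed from left to right, form a monoid. -/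
@[reducible] def pequivMonoid (X : Type*) : Monoid (X ≃. X) where
  mul f g := f.trans g
  one := PEquiv.refl X
  mul_assoc := PEquiv.trans_assoc
  one_mul := PEquiv.refl_trans
  mul_one := PEquiv.trans_refl

/-- Right multiplication by an element of a right cancellative monoid, as a partial bijection with
full domain. -/
noncomputable def mulRightPEquiv {M : Type*} [Monoid M] [IsRightCancelMul M] (m : M) : M ≃. M :=
  open Classical in
  { toFun := fun x => some (x * m)
    invFun := fun y => if h : ∃ x, x * m = y then some h.choose else none
    inv := by
      intro x y
      constructor
      · intro h
        split_ifs at h with h'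
        have := h'.choose_spec
        rw [Option.some_inj.1 h] at this
        exact congrArg some this
      · intro h
        rw [Option.some_inj] at h
        rw [dif_pos ⟨x, h⟩, Option.some_inj]
        exact mul_right_cancel ((Exists.choose_spec (⟨x, h⟩ : ∃ x, x * m = y)).trans h.symm) }

lemma mulRightPEquiv_apply {M : Type*} [Monoid M] [IsRightCancelMul M] (m x : M) :
    mulRightPEquiv m x = some (x * m) := rfl

lemma mulRightPEquiv_mul {M : Type*} [Monoid M] [IsRightCancelMul M] (m m' : M) :
    mulRightPEquiv (m * m') = (mulRightPEquiv m).trans (mulRightPEquiv m') := by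
  ext x y
  simp [PEquiv.trans, mulRightPEquiv_apply, mul_assoc]

lemma pequiv_trans_symm_trans {X : Type*} (f : X ≃. X) : (f.trans f.symm).trans f = f := by
  ext x y
  rw [PEquiv.self_trans_symm, PEquiv.trans_eq_some]
  simp only [PEquiv.ofSet_eq_some_iff]
  constructor
  · rintro ⟨b, ⟨rfl, -⟩, h⟩
    exact h
  · intro h
    exact ⟨x, ⟨rfl, by rw [Set.mem_ofPred_eq, h]; rfl⟩, h⟩

lemma pequiv_idempotents_commute {X : Type*} (f g : X ≃. X) :
    (f.trans f.symm).trans (g.trans g.symm) = (g.trans g.symm).trans (f.trans f.symm) := by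
  ext x y
  simp only [PEquiv.self_trans_symm, PEquiv.trans_eq_some, PEquiv.ofSet_eq_some_iff]
  constructor
  · rintro ⟨b, ⟨rfl, h⟩, rfl, h'⟩
    exact ⟨_, ⟨rfl, h'⟩, rfl, h⟩
  · rintro ⟨b, ⟨rfl, h⟩, rfl, h'⟩
    exact ⟨_, ⟨rfl, h'⟩, rfl, h⟩

/-- If `Mon⟨A | p = q⟩` is right cancellative then it embeds in `Inv⟨A | p q⁻¹ = 1⟩`: the latter
acts on `M = Mon⟨A | p = q⟩` by partial bijections, a letter acting as right multiplication, and
`M` acts faithfully on itself. -/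
theorem naturallyEmbeds_of_isRightCancelMul (p q : List A)
    [IsRightCancelMul (OneRelMonoid p q)] : NaturallyEmbeds p q := by
  let _ := pequivMonoid (OneRelMonoid p q)
  have mul_def : ∀ f g : OneRelMonoid p q ≃. OneRelMonoid p q, f * g = f.trans g := fun _ _ => rfl
  let φ : A × Bool → (OneRelMonoid p q ≃. OneRelMonoid p q) := fun a =>
    if a.2 then mulRightPEquiv (word p q [a.1]) else (mulRightPEquiv (word p q [a.1])).symm
  let ev : List (A × Bool) → (OneRelMonoid p q ≃. OneRelMonoid p q) := fun x => (x.map φ).prod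
  have ev_append : ∀ x y, ev (x ++ y) = (ev x).trans (ev y) := fun x y => by
    simp [ev, mul_def]
  have ev_invRev : ∀ x, ev (FreeGroup.invRev x) = (ev x).symm := by
    intro x
    induction x with
    | nil => rfl
    | cons a x ih =>
      rw [← List.singleton_append, invRev_append, ev_append, ev_append, ih, PEquiv.symm_trans_rev]
      congr 1
      obtain ⟨a, _ | _⟩ := a <;> simp [ev, φ, FreeGroup.invRev]
  have ev_pos : ∀ x, ev (positiveWord x) = mulRightPEquiv (word p q x) := by
    intro x
    induction x with
    | nil =>
      ext m m'
      change m' ∈ PEquiv.refl _ m ↔ _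
      simp [mulRightPEquiv_apply]
    | cons a x ih =>
      have : positiveWord (a :: x) = [(a, true)] ++ positiveWord x := rfl
      rw [this, ev_append, ih, word_cons, mulRightPEquiv_mul]
      simp [ev, φ]
  have hφ : ∀ a b, InvRel (quotientWord p q) a b → FreeMonoid.lift φ a = FreeMonoid.lift φ b := by
    have hl : ∀ x, FreeMonoid.lift φ (FreeMonoid.ofList x) = ev x := fun x => by
      simp [FreeMonoid.lift_apply, ev]
    intro a b h
    cases h with
    | inv_mul x =>
      simp only [hl, ev_append, ev_invRev]
      exact pequiv_trans_symm_trans _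
    | comm x y =>
      simp only [hl, ev_append, ev_invRev]
      exact pequiv_idempotents_commute _ _
    | rel =>
      rw [hl, quotientWord, ev_append, ev_invRev, ev_pos, ev_pos, word_rel, map_one]
      rw [PEquiv.trans_symm_eq_iff_forall_isSome.2]
      · rfl
      · intro a
        rfl
  have lift_pos : ∀ x : List A,
      FreeMonoid.lift (fun a => PresentedMonoid.of (InvRel (quotientWord p q)) (a, true))
        (FreeMonoid.ofList x) = invWord (quotientWord p q) (positiveWord x) := by
    intro x
    induction x with
    | nil => rfl
    | cons a x ih =>
      rw [FreeMonoid.ofList_cons, map_mul, ih]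
      exact (invWord_append _ [(a, true)] (positiveWord x)).symm
  refine ⟨PresentedMonoid.lift
    (fun a => PresentedMonoid.of (InvRel (quotientWord p q)) (a, true)) ?_, fun a => rfl, ?_⟩
  · rintro _ _ ⟨⟩
    rw [lift_pos, lift_pos, invWord_positiveWord_eq]
  · intro m m' h
    obtain ⟨x, rfl⟩ := word_surjective m
    obtain ⟨y, rfl⟩ := word_surjective m'
    have h' : invWord (quotientWord p q) (positiveWord x) =
        invWord (quotientWord p q) (positiveWord y) := by
      rw [← lift_pos, ← lift_pos]; exact h
    have key : ∀ z, PresentedMonoid.lift φ hφ (invWord (quotientWord p q) (positiveWord z)) =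
        mulRightPEquiv (word p q z) := by
      intro z
      rw [← ev_pos]
      change FreeMonoid.lift φ (FreeMonoid.ofList _) = _
      simp [FreeMonoid.lift_apply, ev]
    have h₂ := congrArg (PresentedMonoid.lift φ hφ) h'
    rw [key, key] at h₂
    have h₃ := DFunLike.congr_fun h₂ 1
    simpa [mulRightPEquiv_apply] using h₃

end

/-! ### Reductions between word problems -/

lemma computablePred_comp {α β : Type*} [Primcodable α] [Primcodable β] {q : β → Prop} {f : α → β}
    (hq : ComputablePred q) (hf : Computable f) : ComputablePred fun a => q (f a) := by
  obtain ⟨_, hq⟩ := hq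
  exact ⟨fun a => inferInstance, hq.comp hf⟩

lemma computablePred_and {α : Type*} [Primcodable α] {p q : α → Prop}
    (hp : ComputablePred p) (hq : ComputablePred q) : ComputablePred fun a => p a ∧ q a := by
  obtain ⟨_, hp⟩ := hp
  obtain ⟨_, hq⟩ := hq
  exact ⟨inferInstance, (Primrec.and.to_comp.comp hp hq).of_eq fun a => by simp⟩

section

variable {A B : Type*} [Primcodable A] [Primcodable B]

lemma wordProblemDecidable_of_reduction {u v : List A} {u' v' : List B} {β : Type*}
    [Primcodable β] [DecidableEq β] {f : List A → List B} {g : List A → β} (hf : Computable f)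
    (hg : Computable g)
    (h : ∀ w w', word u v w = word u v w' ↔ word u' v' (f w) = word u' v' (f w') ∧ g w = g w')
    (hd : WordProblemDecidable (MonRel u' v')) : WordProblemDecidable (MonRel u v) := by
  have h₁ : ComputablePred fun p : List A × List A =>
      word u' v' (f p.1) = word u' v' (f p.2) :=
    computablePred_comp (f := fun p : List A × List A => (f p.1, f p.2)) hd
      ((hf.comp .fst).pair (hf.comp .snd))
  have h₂ : ComputablePred fun p : List A × List A => g p.1 = g p.2 :=
    computablePred_comp (f := fun p : List A × List A => (g p.1, g p.2))
      (q := fun p : β × β => p.1 = p.2) (PrimrecPred.computablePred Primrec.eq)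
      ((hg.comp .fst).pair (hg.comp .snd))
  exact (computablePred_and h₁ h₂).of_eq fun p => (h p.1 p.2).symm

lemma wordProblemDecidable_of_map {u v : List A} {u' v' : List B} {f : List A → List B}
    (hf : Computable f)
    (h : ∀ w w', word u v w = word u v w' ↔ word u' v' (f w) = word u' v' (f w'))
    (hd : WordProblemDecidable (MonRel u' v')) : WordProblemDecidable (MonRel u v) :=
  wordProblemDecidable_of_reduction (g := fun _ => ()) hf (.const ()) (by simpa using h) hd

lemma word_eq_comm {A : Type*} {u v w w' : List A} (h : word u v w = word u v w') :
    word v u w = word v u w' :=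
  word_induction (P := fun z => word v u w = word v u z)
    (fun x y hxy => by rw [hxy]; simp only [word_append, word_rel])
    (fun x y hxy => by rw [hxy]; simp only [word_append, word_rel]) h rfl

lemma wordProblemDecidable_comm {u v : List A} (h : WordProblemDecidable (MonRel v u)) :
    WordProblemDecidable (MonRel u v) :=
  wordProblemDecidable_of_map (f := id) .id (fun _ _ => ⟨word_eq_comm, word_eq_comm⟩) h

lemma word_reverse_eq {A : Type*} {u v w w' : List A} (h : word u v w = word u v w') :
    word u.reverse v.reverse w.reverse = word u.reverse v.reverse w'.reverse :=
  word_induction (P := fun z => word u.reverse v.reverse w.reverse =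
      word u.reverse v.reverse z.reverse)
    (fun x y hxy => by
      rw [hxy]; simp only [List.reverse_append, word_append, word_rel (u := u.reverse)])
    (fun x y hxy => by
      rw [hxy]; simp only [List.reverse_append, word_append, word_rel (u := u.reverse)]) h rfl

lemma wordProblemDecidable_reverse {u v : List A}
    (h : WordProblemDecidable (MonRel u.reverse v.reverse)) :
    WordProblemDecidable (MonRel u v) :=
  wordProblemDecidable_of_map (f := List.reverse) .list_reverse
    (fun w w' => ⟨word_reverse_eq, fun h => by
      have := word_reverse_eq h
      rwa [List.reverse_reverse, List.reverse_reverse, List.reverse_reverse,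
        List.reverse_reverse] at this⟩) h

end

/-- The embedding of a right cancellative one-relation monoid in its inverse monoid transfers
decidability of the word problem. -/
lemma wordProblemDecidable_of_isRightCancelMul {n : ℕ} (p q : List (Fin n))
    [IsRightCancelMul (OneRelMonoid p q)]
    (h : WordProblemDecidable (InvRel (quotientWord p q))) :
    WordProblemDecidable (MonRel p q) := by
  obtain ⟨f, hf, hinj⟩ := naturallyEmbeds_of_isRightCancelMul p q
  have hword : ∀ w, f (word p q w) = invWord (quotientWord p q) (positiveWord w) := by
    intro w
    induction w with
    | nil => exact map_one f
    | cons a w ih =>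
      rw [word_cons, map_mul, ih]
      exact (congrArg (· * _) (hf a)).trans (invWord_append _ [(a, true)] (positiveWord w)).symm
  have hpos : Computable (positiveWord : List (Fin n) → List (Fin n × Bool)) :=
    (Primrec.list_map (g := fun _ a => (a, true)) Primrec.id
      (Primrec.pair Primrec.snd (Primrec.const true)).to₂).to_comp
  refine (computablePred_comp
    (f := fun w : List (Fin n) × List (Fin n) => (positiveWord w.1, positiveWord w.2)) h
    ((hpos.comp .fst).pair (hpos.comp .snd))).of_eq fun w => ?_
  change invWord _ (positiveWord w.1) = invWord _ (positiveWord w.2) ↔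
    word p q w.1 = word p q w.2
  rw [← hword, ← hword, hinj.eq_iff]

lemma isReduced_of_snd_eq {A : Type*} {l : List (A × Bool)} (b : Bool) (h : ∀ a ∈ l, a.2 = b) :
    FreeGroup.IsReduced l := by
  refine List.Pairwise.isChain (List.pairwise_iff_forall_sublist.2 fun hs _ => ?_)
  rw [h _ (hs.subset (by simp)), h _ (hs.subset (by simp))]

lemma isReduced_quotientWord_nil {A : Type*} (p : List A) :
    FreeGroup.IsReduced (quotientWord p []) := by
  refine isReduced_of_snd_eq true fun a ha => ?_
  simp only [quotientWord, positiveWord, FreeGroup.invRev, List.map_nil, List.reverse_nil,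
    List.append_nil, List.mem_map] at ha
  obtain ⟨_, -, rfl⟩ := ha
  rfl

lemma isReduced_quotientWord_of_last_ne {A : Type*} (p₀ q₀ : List A) {a b : A} (hab : a ≠ b) :
    FreeGroup.IsReduced (quotientWord (p₀ ++ [a]) (q₀ ++ [b])) := by
  refine List.isChain_append.2 ⟨isReduced_of_snd_eq true ?_, isReduced_of_snd_eq false ?_, ?_⟩
  · simp only [positiveWord, List.mem_map]
    rintro _ ⟨_, -, rfl⟩
    rfl
  · simp only [positiveWord, FreeGroup.invRev, List.mem_map, List.mem_reverse]
    rintro _ ⟨_, ⟨_, -, rfl⟩, rfl⟩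
    rfl
  · simp [positiveWord, FreeGroup.invRev, hab]

/-! ### Passing between finite alphabets and the alphabet `ℕ` -/

lemma wordProblemDecidable_fin_of_nat {n : ℕ} (u v : List (Fin n))
    (h : WordProblemDecidable (MonRel (u.map Fin.val) (v.map Fin.val))) :
    WordProblemDecidable (MonRel u v) := by
  refine wordProblemDecidable_of_map (f := List.map Fin.val)
    (Primrec.list_map Primrec.id (Primrec.fin_val.comp Primrec.snd).to₂).to_comp
    (fun w w' => ⟨fun h => ?_, fun h => ?_⟩) h
  · have := word_flatMap_eq (fun a : Fin n => [a.val]) (u := u) (v := v)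
      (u' := u.map Fin.val) (v' := v.map Fin.val)
    simp only [← List.map_eq_flatMap] at this
    exact this word_rel h
  · -- The letters below `n` act by multiplication, the others trivially.
    let g : ℕ → List (Fin n) := fun k => if h : k < n then [⟨k, h⟩] else []
    have hg : ∀ w : List (Fin n), (w.map Fin.val).flatMap g = w := by
      intro w
      rw [List.flatMap_map]
      simp [g]
    have := word_flatMap_eq g (u := u.map Fin.val) (v := v.map Fin.val) (u' := u) (v' := v)
      (by rw [hg, hg, word_rel]) h
    rwa [hg, hg] at this

/-- A code over a finite alphabet for the letters of the alphabet `ℕ`: the letters below `N` stand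
for themselves, and a letter `k ≥ N` is spelled `yᵏz` with two new letters `y = N`, `z = N + 1`.
The default value of `getD` is never taken. -/
def natCode (N k : ℕ) : List (Fin (N + 2)) :=
  if k < N then [(List.finRange (N + 2)).getD k (Fin.last _)]
  else (List.range k).map (fun _ => (⟨N, by omega⟩ : Fin (N + 2))) ++ [Fin.last _]

lemma primrec_natCode (N : ℕ) : Primrec (natCode N) := by
  refine Primrec.ite (PrimrecRel.comp Primrec.nat_lt Primrec.id (Primrec.const N)) ?_ ?_
  · exact Primrec.list_cons.comp
      ((Primrec.list_getD _).comp (Primrec.const _) Primrec.id) (Primrec.const [])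
  · exact Primrec.list_append.comp (Primrec.list_map Primrec.list_range (Primrec₂.const _))
      (Primrec.const _)

lemma natCode_of_lt {N k : ℕ} (h : k < N) : natCode N k = [⟨k, by omega⟩] := by
  have : k < N + 2 := by omega
  simp [natCode, h, List.getD_eq_getElem?_getD, this]

/-- The word problem over the alphabet `ℕ` reduces to one over a finite alphabet. An automaton with
a counter decodes `natCode`; whatever `u` and `v` are, both leave the counter unchanged. -/
lemma wordProblemDecidable_nat_of_fin {N : ℕ} (u v : List (Fin N))
    (h : WordProblemDecidable (MonRel (u.map (Fin.castAdd 2)) (v.map (Fin.castAdd 2)))) :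
    WordProblemDecidable (MonRel (u.map Fin.val) (v.map Fin.val)) := by
  have hcode : ∀ w : List (Fin N), (w.map Fin.val).flatMap (natCode N) = w.map (Fin.castAdd 2) := by
    intro w
    rw [List.flatMap_map, List.map_eq_flatMap]
    congr 1
    funext k
    rw [natCode_of_lt k.2]
    rfl
  refine wordProblemDecidable_of_map (f := fun w => w.flatMap (natCode N))
    (Primrec.list_flatMap Primrec.id ((primrec_natCode N).comp Primrec.snd).to₂).to_comp
    (fun w w' => ⟨fun h => ?_, fun h => ?_⟩) h
  · refine word_flatMap_eq (natCode N) ?_ h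
    rw [hcode, hcode, word_rel]
  · let U := u.map Fin.val
    let V := v.map Fin.val
    let step : OneRelMonoid U V × ℕ → Fin (N + 2) → OneRelMonoid U V × ℕ := fun x c =>
      if c.val < N then (x.1 * word U V [c.val], x.2)
      else if c.val = N then (x.1, x.2 + 1) else (x.1 * word U V [x.2], 0)
    have hsmall : ∀ (w : List (Fin N)) x, (w.map (Fin.castAdd 2)).foldl step x =
        (x.1 * word U V (w.map Fin.val), x.2) := by
      intro w
      induction w with
      | nil => simp
      | cons a w ih =>
        intro x
        rw [List.map_cons, List.map_cons, List.foldl_cons, ih, word_cons, ← mul_assoc]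
        simp [step]
    have hrep : ∀ (k : ℕ) (x : OneRelMonoid U V × ℕ), (((List.range k).map
        (fun _ => (⟨N, by omega⟩ : Fin (N + 2)))).foldl step x) = (x.1, x.2 + k) := by
      intro k
      induction k with
      | zero => simp
      | succ k ih =>
        intro x
        rw [List.range_succ, List.map_append, List.foldl_append, ih]
        simp [step, add_assoc]
    have hdecode : ∀ (w : List ℕ) (m : OneRelMonoid U V),
        (w.flatMap (natCode N)).foldl step (m, 0) = (m * word U V w, 0) := by
      intro w
      induction w with
      | nil => simp
      | cons k w ih =>
        intro m
        have hk : (natCode N k).foldl step (m, 0) = (m * word U V [k], 0) := by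
          by_cases hk : k < N
          · rw [natCode_of_lt hk]
            simp [step, hk]
          · rw [natCode, if_neg hk, List.foldl_append, hrep]
            simp [step]
        rw [List.flatMap_cons, List.foldl_append, hk, ih, word_cons k w, mul_assoc]
    have := foldl_eq_of_word_eq step (fun _ => True) (fun _ _ _ => trivial)
      (fun x _ => by rw [hsmall, hsmall]; exact congrArg (fun m => (x.1 * m, x.2)) word_rel) h
      (x := (1, 0)) trivial
    rw [hdecode, hdecode] at this
    simpa using congrArg Prod.fst this

/-! ### Compressing relations with common first and last letters -/

/-- The output and the final state of a sequential transducer that reads a word over `ℕ`. -/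
def transduce {S : Type*} (δ : S → ℕ → List ℕ × S) (s : S) (w : List ℕ) : List ℕ × S :=
  w.foldl (fun p c => (p.1 ++ (δ p.2 c).1, (δ p.2 c).2)) ([], s)

section transduce

variable {S : Type*} {δ : S → ℕ → List ℕ × S}

lemma transduce_cons (s : S) (c : ℕ) (w : List ℕ) : transduce δ s (c :: w) =
    ((δ s c).1 ++ (transduce δ (δ s c).2 w).1, (transduce δ (δ s c).2 w).2) := by
  have key : ∀ (w F : List ℕ) (s : S),
      w.foldl (fun p c => (p.1 ++ (δ p.2 c).1, (δ p.2 c).2)) (F, s) =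
        (F ++ (transduce δ s w).1, (transduce δ s w).2) := by
    intro w
    induction w with
    | nil => simp [transduce]
    | cons c w ih =>
      intro F s
      simp only [transduce, List.foldl_cons]
      rw [ih, ih]
      simp
  rw [transduce, List.foldl_cons, key]
  rfl

@[simp] lemma transduce_nil (s : S) : transduce δ s [] = ([], s) := rfl

lemma transduce_append (s : S) (x y : List ℕ) : transduce δ s (x ++ y) =
    ((transduce δ s x).1 ++ (transduce δ (transduce δ s x).2 y).1,
      (transduce δ (transduce δ s x).2 y).2) := by
  induction x generalizing s with
  | nil => simp
  | cons c x ih => simp [transduce_cons, ih]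

lemma length_transduce_le (h : ∀ s c, (δ s c).1.length ≤ 1) (s : S) (w : List ℕ) :
    (transduce δ s w).1.length ≤ w.length := by
  induction w generalizing s with
  | nil => simp
  | cons c w ih =>
    rw [transduce_cons]
    have := h s c
    have := ih (δ s c).2
    simp only [List.length_append, List.length_cons]
    omega

lemma computable_transduce [Primcodable S] (hδ : Primrec₂ δ) (s : S) :
    Computable (transduce δ s) := by
  have hstep : Primrec fun q : List ℕ × ((List ℕ × S) × ℕ) => δ q.2.1.2 q.2.2 :=
    hδ.comp (Primrec.snd.comp (Primrec.fst.comp Primrec.snd)) (Primrec.snd.comp Primrec.snd)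
  exact (Primrec.list_foldl (h := fun _ (q : (List ℕ × S) × ℕ) =>
    (q.1.1 ++ (δ q.1.2 q.2).1, (δ q.1.2 q.2).2)) Primrec.id (Primrec.const ([], s))
    (Primrec.pair (Primrec.list_append.comp (Primrec.fst.comp (Primrec.fst.comp Primrec.snd))
      (Primrec.fst.comp hstep)) (Primrec.snd.comp hstep)).to₂).to_comp

/-- A transducer that, from every state, ends in the same state after `u` and `v`, with outputs
that differ only by a suffix `U` or `V`, induces a map on words modulo the relations. -/
lemma word_transduce_eq {u v U V : List ℕ}
    (h : ∀ s, ∃ o s', transduce δ s u = (o ++ U, s') ∧ transduce δ s v = (o ++ V, s')) (s : S)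
    {w w' : List ℕ} (hw : word u v w = word u v w') :
    word U V (transduce δ s w).1 = word U V (transduce δ s w').1 ∧
      (transduce δ s w).2 = (transduce δ s w').2 := by
  have key : ∀ x y, word U V (transduce δ s (x ++ u ++ y)).1 =
      word U V (transduce δ s (x ++ v ++ y)).1 ∧
      (transduce δ s (x ++ u ++ y)).2 = (transduce δ s (x ++ v ++ y)).2 := by
    intro x y
    obtain ⟨o, s', hu, hv⟩ := h (transduce δ s x).2
    simp only [transduce_append, hu, hv, word_append, word_rel (u := U) (v := V),
      and_self]
  refine word_induction (P := fun z => word U V (transduce δ s w).1 = word U V (transduce δ s z).1 ∧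
    (transduce δ s w).2 = (transduce δ s z).2) ?_ ?_ hw ⟨rfl, rfl⟩
  · rintro x y ⟨h₁, h₂⟩
    exact ⟨h₁.trans (key x y).1, h₂.trans (key x y).2⟩
  · rintro x y ⟨h₁, h₂⟩
    exact ⟨h₁.trans (key x y).1.symm, h₂.trans (key x y).2.symm⟩

end transduce

open Encodable in
/-- The transducer that cuts a word before each `a` and after each `b` and outputs the codes of the
factors; its state is the factor being read. -/
def cutStep (a b : ℕ) (s : List ℕ) (c : ℕ) : List ℕ × List ℕ :=
  if c = a then ([encode s], [a]) else if c = b then ([encode (s ++ [b])], []) else ([], s ++ [c])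

open Encodable in
lemma primrec_cutStep (a b : ℕ) : Primrec₂ (cutStep a b) := by
  have hs : Primrec fun p : List ℕ × ℕ => p.1 := Primrec.fst
  have hc : Primrec fun p : List ℕ × ℕ => p.2 := Primrec.snd
  refine Primrec.ite (PrimrecRel.comp Primrec.eq hc (Primrec.const a)) ?_
    (Primrec.ite (PrimrecRel.comp Primrec.eq hc (Primrec.const b)) ?_ ?_)
  · exact Primrec.pair (Primrec.list_cons.comp (Primrec.encode.comp hs) (Primrec.const []))
      (Primrec.const [a])
  · exact Primrec.pair (Primrec.list_cons.comp (Primrec.encode.comp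
      (Primrec.list_concat.comp hs (Primrec.const b))) (Primrec.const [])) (Primrec.const [])
  · exact Primrec.pair (Primrec.const []) (Primrec.list_concat.comp hs hc)

/-- The word coded by a letter. -/
def decodeWord (k : ℕ) : List ℕ := Denumerable.ofNat (List ℕ) k

lemma flatMap_transduce_cutStep (a b : ℕ) (s w : List ℕ) :
    (transduce (cutStep a b) s w).1.flatMap decodeWord ++ (transduce (cutStep a b) s w).2 =
      s ++ w := by
  induction w generalizing s with
  | nil => simp
  | cons c w ih =>
    rw [transduce_cons, List.flatMap_append, List.append_assoc, ih, ← List.append_assoc]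
    unfold cutStep
    split_ifs with h₁ h₂ <;> simp [decodeWord, *]

/-- Compression for relations whose two sides begin with `a` and end with `b ≠ a`. Cutting before
each `a` and after each `b` makes both sides products of whole factors, so that the relation becomes
a relation between the sequences of factors, which are shorter. -/
lemma exists_compression_of_ne {a b : ℕ} (hab : a ≠ b) (u₀ v₀ : List ℕ) :
    ∃ U V : List ℕ, U.length ≤ u₀.length + 1 ∧ V.length ≤ v₀.length + 1 ∧
      (WordProblemDecidable (MonRel U V) →
        WordProblemDecidable (MonRel (a :: (u₀ ++ [b])) (a :: (v₀ ++ [b])))) := by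
  have hlen : ∀ w s, (transduce (cutStep a b) s w).1.length ≤ w.length := fun w s =>
    length_transduce_le (fun s c => by unfold cutStep; split_ifs <;> simp) s w
  have hstate : ∀ s w, (transduce (cutStep a b) s (w ++ [b])).2 = [] := by
    intro s w
    simp [transduce_append, transduce_cons, cutStep, hab.symm]
  have hrun : ∀ s w, transduce (cutStep a b) s (a :: (w ++ [b])) =
      ([Encodable.encode s] ++ (transduce (cutStep a b) [a] (w ++ [b])).1, []) := by
    intro s w
    rw [transduce_cons]
    have : cutStep a b s a = ([Encodable.encode s], [a]) := by simp [cutStep]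
    rw [this, hstate]
  have hjoin : ∀ w, (transduce (cutStep a b) [a] (w ++ [b])).1.flatMap decodeWord =
      a :: (w ++ [b]) := by
    intro w
    have := flatMap_transduce_cutStep a b [a] (w ++ [b])
    rwa [hstate, List.append_nil] at this
  refine ⟨(transduce (cutStep a b) [a] (u₀ ++ [b])).1, (transduce (cutStep a b) [a] (v₀ ++ [b])).1,
    by simpa using hlen (u₀ ++ [b]) [a], by simpa using hlen (v₀ ++ [b]) [a],
    wordProblemDecidable_of_reduction
      (Computable.fst.comp (computable_transduce (primrec_cutStep a b) []))
      (Computable.snd.comp (computable_transduce (primrec_cutStep a b) []))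
      fun w w' => ⟨fun h => ?_, fun h => ?_⟩⟩
  · exact word_transduce_eq (fun s => ⟨[Encodable.encode s], [], hrun s u₀, hrun s v₀⟩) [] h
  · have h₁ := word_flatMap_eq decodeWord (u' := a :: (u₀ ++ [b])) (v' := a :: (v₀ ++ [b]))
      (by rw [hjoin, hjoin, word_rel]) h.1
    have hw := flatMap_transduce_cutStep a b [] w
    have hw' := flatMap_transduce_cutStep a b [] w'
    rw [List.nil_append] at hw hw'
    rw [← hw, ← hw', word_append, word_append, h₁, h.2]

open Encodable in
/-- The transducer that splits a word at the occurrences of `a` and outputs the codes of the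
intermediate words; its state is the word being read and a flag, which tells whether an `a` has
been read and which is recorded in the code of each word. -/
def splitStep (a : ℕ) (s : Bool × List ℕ) (c : ℕ) : List ℕ × (Bool × List ℕ) :=
  if c = a then ([encode s], (true, [])) else ([], (s.1, s.2 ++ [c]))

lemma primrec_splitStep (a : ℕ) : Primrec₂ (splitStep a) := by
  have hs : Primrec fun p : (Bool × List ℕ) × ℕ => p.1 := Primrec.fst
  have hc : Primrec fun p : (Bool × List ℕ) × ℕ => p.2 := Primrec.snd
  refine Primrec.ite (PrimrecRel.comp Primrec.eq hc (Primrec.const a)) ?_ ?_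
  · exact Primrec.pair (Primrec.list_cons.comp (Primrec.encode.comp hs) (Primrec.const []))
      (Primrec.const _)
  · exact Primrec.pair (Primrec.const []) (Primrec.pair (Primrec.fst.comp hs)
      (Primrec.list_concat.comp (Primrec.snd.comp hs) hc))

section unsplit

variable {u v : List ℕ}

/-- The action that recovers a word from the output of `splitStep a`: a code `(true, t)` multiplies
by `t a`, a code `(false, t)` starts afresh with `t a`. Letters that are not codes are read as `(false, [])`. -/
def unsplitStep (u v : List ℕ) (a : ℕ) (m : Option (OneRelMonoid u v)) (k : ℕ) :
    Option (OneRelMonoid u v) :=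
  let s : Bool × List ℕ := (Encodable.decode k).getD (false, [])
  if s.1 then m.map (· * word u v (s.2 ++ [a])) else some (word u v (s.2 ++ [a]))

/-- The element represented by the part of a word that has been read, given what its transduced
part recovers (`none` if there is no `a` yet) and the state of the transducer. -/
def unsplitValue (m : Option (OneRelMonoid u v)) (s : Bool × List ℕ) : OneRelMonoid u v :=
  m.getD 1 * word u v s.2

lemma unsplit_transduce (a : ℕ) (w : List ℕ) (m : Option (OneRelMonoid u v)) (s : Bool × List ℕ)
    (hm : m.isSome = s.1) :
    let r := transduce (splitStep a) s w
    (r.1.foldl (unsplitStep u v a) m).isSome = r.2.1 ∧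
      unsplitValue (r.1.foldl (unsplitStep u v a) m) r.2 = unsplitValue m s * word u v w := by
  induction w generalizing m s with
  | nil => simpa using hm
  | cons c w ih =>
    simp only [transduce_cons, List.foldl_append]
    have key : ((splitStep a s c).1.foldl (unsplitStep u v a) m).isSome = (splitStep a s c).2.1 ∧
        unsplitValue ((splitStep a s c).1.foldl (unsplitStep u v a) m) (splitStep a s c).2 =
          unsplitValue m s * word u v [c] := by
      obtain ⟨f, t⟩ := s
      by_cases hc : c = a
      · subst hc
        cases m <;> simp only [Option.isSome_none, Option.isSome_some] at hm <;> subst hm <;>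
          simp [splitStep, unsplitStep, unsplitValue, word_append, mul_assoc]
      · simp [splitStep, hc, unsplitValue, hm, word_append, mul_assoc]
    obtain ⟨h₁, h₂⟩ := ih _ _ key.1
    refine ⟨h₁, h₂.trans ?_⟩
    rw [key.2, word_cons c w, mul_assoc]

lemma unsplit_transduce_none (a : ℕ) (w t : List ℕ) :
    (transduce (splitStep a) (true, t) w).1.foldl (unsplitStep u v a) none = none := by
  induction w generalizing t with
  | nil => rfl
  | cons c w ih =>
    rw [transduce_cons, List.foldl_append]
    by_cases hc : c = a
    · subst hc
      simpa [splitStep, unsplitStep] using ih []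
    · simpa [splitStep, hc] using ih (t ++ [c])

end unsplit

/-- Compression for relations whose two sides begin and end with the same letter `a`. An
occurrence of `u = a t₁ a ⋯ tₘ a` in a word is an occurrence of `t₁, …, tₘ` in the sequence of words
between the occurrences of `a`. -/
lemma exists_compression_of_eq {a : ℕ} (u₀ v₀ : List ℕ)
    (hu : u₀ = [] ∨ ∃ u₁, u₀ = u₁ ++ [a]) (hv : v₀ = [] ∨ ∃ v₁, v₀ = v₁ ++ [a]) :
    ∃ U V : List ℕ, U.length ≤ u₀.length ∧ V.length ≤ v₀.length ∧
      (WordProblemDecidable (MonRel U V) →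
        WordProblemDecidable (MonRel (a :: u₀) (a :: v₀))) := by
  have hlen : ∀ w s, (transduce (splitStep a) s w).1.length ≤ w.length := fun w s =>
    length_transduce_le (fun s c => by unfold splitStep; split_ifs <;> simp) s w
  have hstate : ∀ w, (w = [] ∨ ∃ w₁, w = w₁ ++ [a]) →
      (transduce (splitStep a) (true, []) w).2 = (true, []) := by
    rintro w (rfl | ⟨w, rfl⟩)
    · rfl
    · simp [transduce_append, transduce_cons, splitStep]
  have hrun : ∀ s w, (w = [] ∨ ∃ w₁, w = w₁ ++ [a]) → transduce (splitStep a) s (a :: w) =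
      ([Encodable.encode s] ++ (transduce (splitStep a) (true, []) w).1, (true, [])) := by
    intro s w hw
    rw [transduce_cons]
    have : splitStep a s a = ([Encodable.encode s], (true, [])) := by simp [splitStep]
    rw [this, hstate w hw]
  refine ⟨(transduce (splitStep a) (true, []) u₀).1, (transduce (splitStep a) (true, []) v₀).1,
    hlen u₀ _, hlen v₀ _,
    wordProblemDecidable_of_reduction
      (Computable.fst.comp (computable_transduce (primrec_splitStep a) (false, [])))
      (Computable.snd.comp (computable_transduce (primrec_splitStep a) (false, [])))
      fun w w' => ⟨fun h => ?_, fun h => ?_⟩⟩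
  · exact word_transduce_eq
      (fun s => ⟨[Encodable.encode s], (true, []), hrun s u₀ hu, hrun s v₀ hv⟩) _ h
  · -- The relation `t₁ ⋯ tₘ = t'₁ ⋯ t'ₗ` holds for the action on elements that end in `a`.
    have hact : ∀ (m : OneRelMonoid (a :: u₀) (a :: v₀)) w, (w = [] ∨ ∃ w₁, w = w₁ ++ [a]) →
        (transduce (splitStep a) (true, []) w).1.foldl (unsplitStep (a :: u₀) (a :: v₀) a)
          (some (m * word _ _ [a])) = some (m * word _ _ (a :: w)) := by
      intro m w hw
      obtain ⟨h₁, h₂⟩ := unsplit_transduce a w (some (m * word _ _ [a])) (true, []) rfl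
      rw [hstate w hw] at h₁ h₂
      obtain ⟨m', hm'⟩ := Option.isSome_iff_exists.1 h₁
      rw [hm'] at h₂ ⊢
      simp only [unsplitValue, Option.getD_some, word_nil, mul_one] at h₂
      rw [h₂, word_cons a w, mul_assoc]
    have hfold := foldl_eq_of_word_eq (unsplitStep (a :: u₀) (a :: v₀) a)
      (fun m => ∀ m' ∈ m, ∃ m'', m' = m'' * word _ _ [a])
      (by
        intro m k hm m' hm'
        simp only [unsplitStep] at hm'
        split_ifs at hm'
        · obtain ⟨m₁, -, rfl⟩ := Option.mem_map.1 hm'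
          exact ⟨_, by rw [word_append, ← mul_assoc]⟩
        · obtain rfl := Option.some_inj.1 hm'
          exact ⟨_, word_append _ _⟩)
      (by
        rintro (_ | m) hm
        · rw [unsplit_transduce_none, unsplit_transduce_none]
        · obtain ⟨m', rfl⟩ := hm m rfl
          rw [hact m' u₀ hu, hact m' v₀ hv, word_rel])
      h.1 (x := none) (by simp)
    have hw := (unsplit_transduce (u := a :: u₀) (v := a :: v₀) a w none (false, []) rfl).2
    have hw' := (unsplit_transduce (u := a :: u₀) (v := a :: v₀) a w' none (false, []) rfl).2
    rw [← hfold, ← h.2, hw] at hw'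
    simpa [unsplitValue] using hw'

/-- The word problem for one-relation monoids reduces to the case of a relation whose sides
end in different letters and to the case of a relation `u = 1`. -/
lemma wordProblemDecidable_nat
    (hlast : ∀ (u₀ v₀ : List ℕ) (a b : ℕ), a ≠ b →
      WordProblemDecidable (MonRel (u₀ ++ [a]) (v₀ ++ [b])))
    (hnil : ∀ u : List ℕ, WordProblemDecidable (MonRel u [])) (u v : List ℕ) :
    WordProblemDecidable (MonRel u v) := by
  induction hk : u.length + v.length using Nat.strong_induction_on generalizing u v with
  | _ k ih =>
    subst hk
    rcases u with _ | ⟨a, u⟩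
    · exact wordProblemDecidable_comm (hnil v)
    rcases v with _ | ⟨a', v⟩
    · exact hnil _
    by_cases haa' : a = a'
    swap
    · refine wordProblemDecidable_reverse ?_
      simpa using hlast u.reverse v.reverse a a' haa'
    subst haa'
    have compress : ∀ U V : List ℕ, U.length ≤ u.length → V.length ≤ v.length →
        WordProblemDecidable (MonRel U V) := fun U V hU hV =>
      ih _ (by simp only [List.length_cons]; omega) U V rfl
    have key : ∀ (l : List ℕ), l ≠ [] → ∃ l' b, l = l' ++ [b] := fun l hl => by
      rcases List.eq_nil_or_concat' l with h | h
      · exact absurd h hl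
      · exact h
    obtain ⟨u₁, b, hu⟩ := key (a :: u) (by simp)
    obtain ⟨v₁, b', hv⟩ := key (a :: v) (by simp)
    by_cases hbb' : b = b'
    swap
    · rw [hu, hv]
      exact hlast _ _ _ _ hbb'
    subst hbb'
    have tail : ∀ x y : List ℕ, a :: x = y ++ [b] →
        (x = [] ∧ b = a) ∨ ∃ x₁, x = x₁ ++ [b] := by
      rintro x (_ | ⟨c, y⟩) h
      · simp only [List.nil_append, List.cons.injEq] at h
        exact .inl ⟨h.2, h.1.symm⟩
      · simp only [List.cons_append, List.cons.injEq] at h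
        exact .inr ⟨y, h.2⟩
    have htu := tail u u₁ hu
    have htv := tail v v₁ hv
    by_cases hab : b = a
    · subst hab
      obtain ⟨U, V, hU, hV, h⟩ := exists_compression_of_eq u v (htu.imp_left And.left)
        (htv.imp_left And.left)
      exact h (compress U V hU hV)
    · obtain ⟨u₂, rfl⟩ := htu.resolve_left fun h => hab h.2
      obtain ⟨v₂, rfl⟩ := htv.resolve_left fun h => hab h.2
      obtain ⟨U, V, hU, hV, h⟩ := exists_compression_of_ne (Ne.symm hab) u₂ v₂
      exact h (compress U V (by simpa using hU) (by simpa using hV))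

/-! ### Words representing units -/

section units

lemma isUnit_of_isUnit_mul_of_isUnit_mul {M : Type*} [Monoid M] {p q r : M} (h₁ : IsUnit (p * q))
    (h₂ : IsUnit (q * r)) : IsUnit q := by
  obtain ⟨x, hx⟩ := h₁.exists_left_inv
  obtain ⟨y, hy⟩ := h₂.exists_right_inv
  have hl : (x * p) * q = 1 := by rw [mul_assoc, hx]
  have hr : q * (r * y) = 1 := by rw [← mul_assoc, hy]
  exact ⟨⟨q, x * p, by rw [left_inv_eq_right_inv hl hr, hr], hl⟩, rfl⟩

lemma isUnit_mul_iff_right {M : Type*} [Monoid M] {x y : M} (hx : IsUnit x) :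
    IsUnit (x * y) ↔ IsUnit y := by
  obtain ⟨x, rfl⟩ := hx
  exact Units.isUnit_units_mul x y

lemma isUnit_mul_iff_left {M : Type*} [Monoid M] {x y : M} (hy : IsUnit y) :
    IsUnit (x * y) ↔ IsUnit x := by
  obtain ⟨y, rfl⟩ := hy
  exact Units.isUnit_mul_units x y

variable {A : Type*} {u v : List A}

variable (u v) in
/-- A nonempty word that represents a unit and has no nonempty proper prefix that represents a
unit. These words freely generate the monoid of all words that represent units. -/
structure IsMinimalUnit (δ : List A) : Prop where
  ne_nil : δ ≠ []
  isUnit : IsUnit (word u v δ)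
  not_isUnit_prefix : ∀ p q, δ = p ++ q → p ≠ [] → q ≠ [] → ¬ IsUnit (word u v p)

lemma isUnit_word_flatten {ds : List (List A)} (h : ∀ δ ∈ ds, IsMinimalUnit u v δ) :
    IsUnit (word u v ds.flatten) := by
  induction ds with
  | nil => simp
  | cons δ ds ih =>
    rw [List.flatten_cons, word_append]
    exact (h δ (by simp)).isUnit.mul (ih fun δ' hδ' => h δ' (by simp [hδ']))

lemma exists_factorization {w : List A} (hw : IsUnit (word u v w)) :
    ∃ ds : List (List A), (∀ δ ∈ ds, IsMinimalUnit u v δ) ∧ ds.flatten = w := by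
  induction hk : w.length using Nat.strong_induction_on generalizing w with
  | _ k ih =>
    subst hk
    by_cases hw₀ : w = []
    · exact ⟨[], by simp, by simp [hw₀]⟩
    by_cases hmin : IsMinimalUnit u v w
    · exact ⟨[w], by simpa using hmin, by simp⟩
    have : ∃ p q, w = p ++ q ∧ p ≠ [] ∧ q ≠ [] ∧ IsUnit (word u v p) := by
      by_contra! hcon
      exact hmin ⟨hw₀, hw, fun p q h hp hq => hcon p q h hp hq⟩
    obtain ⟨p, q, rfl, hp, hq, hpu⟩ := this
    rw [word_append, isUnit_mul_iff_right hpu] at hw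
    have hpl : p.length < (p ++ q).length := by simpa using List.length_pos_iff.2 hq
    have hql : q.length < (p ++ q).length := by simpa using List.length_pos_iff.2 hp
    obtain ⟨ds₁, h₁, rfl⟩ := ih p.length hpl hpu rfl
    obtain ⟨ds₂, h₂, rfl⟩ := ih q.length hql hw rfl
    exact ⟨ds₁ ++ ds₂, fun δ hδ => (List.mem_append.1 hδ).elim (h₁ δ) (h₂ δ), by simp⟩

lemma factorization_unique {ds ds' : List (List A)} (h : ∀ δ ∈ ds, IsMinimalUnit u v δ)
    (h' : ∀ δ ∈ ds', IsMinimalUnit u v δ) (heq : ds.flatten = ds'.flatten) : ds = ds' := by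
  induction ds generalizing ds' with
  | nil =>
    rcases ds' with _ | ⟨δ', ds'⟩
    · rfl
    · simp [(h' δ' (by simp)).ne_nil] at heq
  | cons δ ds ih =>
    rcases ds' with _ | ⟨δ', ds'⟩
    · simp [(h δ (by simp)).ne_nil] at heq
    have hδ := h δ (by simp)
    have hδ' := h' δ' (by simp)
    have : δ = δ' := by
      rw [List.flatten_cons, List.flatten_cons, List.append_eq_append_iff] at heq
      rcases heq with ⟨a, ha, -⟩ | ⟨a, ha, -⟩
      · by_contra hne
        exact hδ'.not_isUnit_prefix δ a ha hδ.ne_nil (by rintro rfl; simp [ha] at hne) hδ.isUnit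
      · by_contra hne
        exact hδ.not_isUnit_prefix δ' a ha hδ'.ne_nil (by rintro rfl; simp [ha] at hne) hδ'.isUnit
    subst this
    rw [List.flatten_cons, List.flatten_cons, List.append_cancel_left_eq] at heq
    rw [ih (fun δ' hd => h δ' (by simp [hd])) (fun δ' hd => h' δ' (by simp [hd])) heq]

lemma factorization_split {ds : List (List A)} (h : ∀ δ ∈ ds, IsMinimalUnit u v δ) {s r : List A}
    (heq : ds.flatten = s ++ r) (hs : IsUnit (word u v s)) :
    ∃ d₁ d₂, ds = d₁ ++ d₂ ∧ d₁.flatten = s ∧ d₂.flatten = r := by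
  have hr := isUnit_word_flatten h
  rw [heq, word_append, isUnit_mul_iff_right hs] at hr
  obtain ⟨d₁, h₁, rfl⟩ := exists_factorization hs
  obtain ⟨d₂, h₂, rfl⟩ := exists_factorization hr
  refine ⟨d₁, d₂, factorization_unique h ?_ (by simpa using heq), rfl, rfl⟩
  exact fun δ hδ => (List.mem_append.1 hδ).elim (h₁ δ) (h₂ δ)

/-- The position of a factor `s` representing a unit in a product of minimal words: it is the
product of some of the factors, or it lies strictly inside a single factor. -/
lemma factorization_factor {ds : List (List A)} (h : ∀ δ ∈ ds, IsMinimalUnit u v δ)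
    {p s r : List A} (heq : ds.flatten = p ++ s ++ r) (hs : IsUnit (word u v s)) :
    (∃ d₁ d₂ d₃, ds = d₁ ++ d₂ ++ d₃ ∧ d₁.flatten = p ∧ d₂.flatten = s ∧ d₃.flatten = r) ∨
    ∃ d₁ p' r' d₃, ds = d₁ ++ [p' ++ s ++ r'] ++ d₃ ∧ p = d₁.flatten ++ p' ∧
      r = r' ++ d₃.flatten ∧ p' ≠ [] ∧ r' ≠ [] := by
  induction ds generalizing p with
  | nil =>
    left
    simp only [List.flatten_nil, List.nil_eq, List.append_eq_nil_iff] at heq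
    obtain ⟨⟨rfl, rfl⟩, rfl⟩ := heq
    exact ⟨[], [], [], by simp⟩
  | cons δ ds ih =>
    have hδ := h δ (by simp)
    by_cases hp : p = []
    · subst hp
      obtain ⟨d₂, d₃, hd, rfl, rfl⟩ := factorization_split h (by simpa using heq) hs
      exact .inl ⟨[], d₂, d₃, by simpa using hd, by simp⟩
    rw [List.flatten_cons, List.append_assoc, List.append_eq_append_iff] at heq
    rcases heq with ⟨p₂, rfl, hds⟩ | ⟨q, rfl, hds⟩
    · rcases ih (fun δ' hd => h δ' (by simp [hd])) (by rw [hds, List.append_assoc]) with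
        ⟨d₁, d₂, d₃, rfl, rfl, rfl, rfl⟩ | ⟨d₁, p', r', d₃, rfl, rfl, rfl, hp', hr'⟩
      · exact .inl ⟨δ :: d₁, d₂, d₃, by simp⟩
      · exact .inr ⟨δ :: d₁, p', r', d₃, by simp, by simp, rfl, hp', hr'⟩
    by_cases hq : q = []
    · subst hq
      obtain ⟨d₂, d₃, hd, hd₂, rfl⟩ := factorization_split (ds := ds) (s := s) (r := r)
        (fun δ' hd => h δ' (by simp [hd])) (by simpa using hds.symm) hs
      exact .inl ⟨[p], d₂, d₃, by simp [hd], by simp [hd₂]⟩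
    -- A suffix `q` of a unit that is also a prefix of a unit is a unit, which is impossible.
    have hnu := hδ.not_isUnit_prefix p q rfl hp hq
    have hqu : ¬ IsUnit (word u v q) := by
      intro hqu
      have := hδ.isUnit
      rw [word_append, isUnit_mul_iff_left hqu] at this
      exact hnu this
    have hpq := hδ.isUnit
    rw [word_append] at hpq
    rw [List.append_eq_append_iff] at hds
    rcases hds with ⟨r', rfl, rfl⟩ | ⟨s', rfl, hds⟩
    · by_cases hr' : r' = []
      · subst hr'
        exact absurd (by simpa using hs) hqu
      · exact .inr ⟨[], p, r', ds, by simp, by simp, by simp, hp, hr'⟩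
    · rw [word_append] at hs
      exact absurd (isUnit_of_isUnit_mul_of_isUnit_mul hpq hs) hqu

/-- Replacing an inner factor that represents a unit by an equal word preserves minimality. -/
lemma IsMinimalUnit.replace {p s t r : List A} (h : IsMinimalUnit u v (p ++ s ++ r)) (hp : p ≠ [])
    (hr : r ≠ []) (hs : IsUnit (word u v s)) (hst : word u v s = word u v t) :
    IsMinimalUnit u v (p ++ t ++ r) := by
  have hpu : ¬ IsUnit (word u v p) :=
    h.not_isUnit_prefix p (s ++ r) (by simp) hp (by simp [hr])
  refine ⟨by simp [hp], ?_, ?_⟩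
  · have := h.isUnit
    simpa only [word_append, hst] using this
  · intro x y hxy hx hy hxu
    rw [List.append_assoc, List.append_eq_append_iff] at hxy
    rcases hxy with ⟨x', rfl, hxy⟩ | ⟨y', rfl, -⟩
    · rw [List.append_eq_append_iff] at hxy
      rcases hxy with ⟨x'', rfl, rfl⟩ | ⟨t', rfl, -⟩
      · refine h.not_isUnit_prefix (p ++ s ++ x'') y (by simp) (by simp [hp]) hy ?_
        simpa only [word_append, hst, mul_assoc] using hxu
      · rw [hst, word_append] at hs
        rw [word_append] at hxu
        have hx' := isUnit_of_isUnit_mul_of_isUnit_mul hxu hs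
        exact hpu ((isUnit_mul_iff_left hx').1 hxu)
    · exact h.not_isUnit_prefix x (y' ++ (s ++ r)) (by simp) hx (by simp [hr]) hxu

end units

/-! ### The group of units of a special one-relation monoid -/

section special

variable {A ι : Type*} {u : List A}

/-- Letters for the units represented by the minimal factors of the relator `u`: `val` maps a letter
to its unit, and `pieces` is the factorization of `u` into minimal words, each with its letter. Two
factors get the same letter exactly if they are equal in the monoid. -/
structure PieceLabels (u : List A) (ι : Type*) where
  val : ι → OneRelMonoid u []
  val_injective : Function.Injective val
  pieces : List (List A × ι)
  isMinimalUnit : ∀ x ∈ pieces, IsMinimalUnit u [] x.1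
  word_eq_val : ∀ x ∈ pieces, word u [] x.1 = val x.2
  flatten_eq : (pieces.map Prod.fst).flatten = u
  mem_pieces : ∀ i, ∃ x ∈ pieces, x.2 = i

namespace PieceLabels

variable (P : PieceLabels u ι)

/-- The relator `u` as a word in the letters that label its factors. -/
def relator : List ι := P.pieces.map Prod.snd

/-- A word `w` evaluates to `γ` if it is a product of minimal words that represent the same units
as the letters of a word representing `γ` in `Mon⟨ι | relator = 1⟩`. -/
def Eval (w : List A) (γ : OneRelMonoid P.relator []) : Prop :=
  ∃ L : List (List A × ι), (∀ x ∈ L, IsMinimalUnit u [] x.1 ∧ word u [] x.1 = P.val x.2) ∧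
    (L.map Prod.fst).flatten = w ∧ word P.relator [] (L.map Prod.snd) = γ

variable {P}

lemma word_flatten_eq {L : List (List A × ι)} (hL : ∀ x ∈ L, word u [] x.1 = P.val x.2) :
    word u [] (L.map Prod.fst).flatten = ((L.map Prod.snd).map P.val).prod := by
  induction L with
  | nil => rfl
  | cons x L ih =>
    simp only [List.map_cons, List.flatten_cons, word_append, List.prod_cons]
    rw [ih fun y hy => hL y (by simp [hy]), hL x (by simp)]

variable (P) in
/-- The homomorphism from `Mon⟨ι | relator = 1⟩` that sends a letter to the unit it labels. -/
def toMonoid : OneRelMonoid P.relator [] →* OneRelMonoid u [] :=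
  PresentedMonoid.lift P.val <| by
    rintro _ _ ⟨⟩
    have h := word_flatten_eq (P := P) (L := P.pieces) P.word_eq_val
    rw [P.flatten_eq, word_rel] at h
    simpa [FreeMonoid.lift_apply, relator] using h.symm

lemma toMonoid_word (σ : List ι) : P.toMonoid (word P.relator [] σ) = (σ.map P.val).prod :=
  lift_word _ _ σ

lemma Eval.word_eq {w : List A} {γ : OneRelMonoid P.relator []} (h : P.Eval w γ) :
    word u [] w = P.toMonoid γ := by
  obtain ⟨L, hL, rfl, rfl⟩ := h
  rw [toMonoid_word, word_flatten_eq fun x hx => (hL x hx).2]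

lemma Eval.isUnit {w : List A} {γ : OneRelMonoid P.relator []} (h : P.Eval w γ) :
    IsUnit (word u [] w) := by
  obtain ⟨L, hL, rfl, rfl⟩ := h
  exact isUnit_word_flatten fun δ hδ => by
    obtain ⟨x, hx, rfl⟩ := List.mem_map.1 hδ
    exact (hL x hx).1

lemma Eval.unique {w : List A} {γ γ' : OneRelMonoid P.relator []} (h : P.Eval w γ)
    (h' : P.Eval w γ') : γ = γ' := by
  obtain ⟨L, hL, rfl, rfl⟩ := h
  obtain ⟨L', hL', heq, rfl⟩ := h'
  have hfst : L'.map Prod.fst = L.map Prod.fst := by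
    refine factorization_unique (u := u) (v := []) ?_ ?_ heq
    · intro δ hδ
      obtain ⟨x, hx, rfl⟩ := List.mem_map.1 hδ
      exact (hL' x hx).1
    · intro δ hδ
      obtain ⟨x, hx, rfl⟩ := List.mem_map.1 hδ
      exact (hL x hx).1
  have hval : ∀ L : List (List A × ι),
      (∀ x ∈ L, IsMinimalUnit u [] x.1 ∧ word u [] x.1 = P.val x.2) →
      (L.map Prod.snd).map P.val = (L.map Prod.fst).map (word u []) := by
    intro L hL
    rw [List.map_map, List.map_map]
    exact List.map_congr_left fun x hx => (hL x hx).2.symm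
  have : L.map Prod.snd = L'.map Prod.snd :=
    P.val_injective.list_map (by rw [hval L hL, hval L' hL', hfst])
  rw [this]

lemma eval_nil : P.Eval [] 1 := ⟨[], by simp⟩

lemma eval_relator : P.Eval u 1 :=
  ⟨P.pieces, fun x hx => ⟨P.isMinimalUnit x hx, P.word_eq_val x hx⟩, P.flatten_eq, word_rel⟩

lemma Eval.replace {p s t r : List A} {γ η : OneRelMonoid P.relator []}
    (h : P.Eval (p ++ s ++ r) γ) (hs : P.Eval s η) (ht : P.Eval t η) :
    P.Eval (p ++ t ++ r) γ := by
  obtain ⟨L, hL, heq, rfl⟩ := h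
  have hmin : ∀ δ ∈ L.map Prod.fst, IsMinimalUnit u [] δ := by
    intro δ hδ
    obtain ⟨x, hx, rfl⟩ := List.mem_map.1 hδ
    exact (hL x hx).1
  have hst : word u [] s = word u [] t := by rw [hs.word_eq, ht.word_eq]
  rcases factorization_factor hmin heq hs.isUnit with
    ⟨d₁, d₂, d₃, hd, rfl, rfl, rfl⟩ | ⟨d₁, p', r', d₃, hd, rfl, rfl, hp', hr'⟩
  · obtain ⟨L₁₂, L₃, rfl, hL₁₂, rfl⟩ := List.map_eq_append_iff.1 hd
    obtain ⟨L₁, L₂, rfl, rfl, rfl⟩ := List.map_eq_append_iff.1 hL₁₂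
    obtain ⟨T, hT, rfl, hTη⟩ := ht
    have h₂ : word P.relator [] (L₂.map Prod.snd) = η :=
      Eval.unique ⟨L₂, fun x hx => hL x (by simp [hx]), rfl, rfl⟩ hs
    refine ⟨L₁ ++ T ++ L₃, ?_, by simp, ?_⟩
    · intro x hx
      simp only [List.mem_append] at hx
      rcases hx with (hx | hx) | hx
      exacts [hL x (by simp [hx]), hT x hx, hL x (by simp [hx])]
    · simp only [List.map_append, word_append, hTη, h₂]
  · obtain ⟨L₁₂, L₃, rfl, hL₁₂, rfl⟩ := List.map_eq_append_iff.1 hd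
    obtain ⟨L₁, L₂, rfl, rfl, hL₂⟩ := List.map_eq_append_iff.1 hL₁₂
    obtain ⟨⟨δ, i⟩, rfl, hδ⟩ := List.map_eq_singleton_iff.1 hL₂
    obtain rfl : δ = p' ++ s ++ r' := hδ
    have hδ := hL (p' ++ s ++ r', i) (by simp)
    refine ⟨L₁ ++ [(p' ++ t ++ r', i)] ++ L₃, ?_, by simp, by simp⟩
    intro x hx
    simp only [List.mem_append, List.mem_singleton] at hx
    rcases hx with (hx | rfl) | hx
    · exact hL x (by simp [hx])
    · refine ⟨hδ.1.replace hp' hr' hs.isUnit hst, ?_⟩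
      have := hδ.2
      simpa only [word_append, hst] using this
    · exact hL x (by simp [hx])

lemma Eval.of_word_eq {w w' : List A} {γ : OneRelMonoid P.relator []}
    (h : word u [] w = word u [] w') (hw : P.Eval w γ) : P.Eval w' γ :=
  word_induction (P := fun z => P.Eval z γ) (fun _ _ hz => hz.replace eval_relator eval_nil)
    (fun _ _ hz => hz.replace eval_nil eval_relator) h hw

lemma exists_eval (γ : OneRelMonoid P.relator []) : ∃ w, P.Eval w γ := by
  obtain ⟨σ, rfl⟩ := word_surjective γ
  choose f hf hfi using P.mem_pieces
  refine ⟨_, σ.map f, ?_, rfl, ?_⟩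
  · intro x hx
    obtain ⟨i, -, rfl⟩ := List.mem_map.1 hx
    exact ⟨P.isMinimalUnit _ (hf i), P.word_eq_val _ (hf i)⟩
  · rw [List.map_map]
    congr 1
    exact List.map_id'' hfi σ

/-- `Mon⟨ι | relator = 1⟩` is a submonoid of the group of units of the special monoid. -/
lemma toMonoid_injective : Function.Injective P.toMonoid := by
  intro γ γ' h
  obtain ⟨w, hw⟩ := exists_eval γ
  obtain ⟨w', hw'⟩ := exists_eval γ'
  exact (hw.of_word_eq (by rw [hw.word_eq, hw'.word_eq, h])).unique hw'

variable (P) in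
lemma isRightCancelMul : IsRightCancelMul (OneRelMonoid P.relator []) := by
  refine ⟨fun γ x y h => toMonoid_injective ?_⟩
  obtain ⟨w, hw⟩ := exists_eval γ
  have hγ : IsUnit (P.toMonoid γ) := hw.word_eq ▸ hw.isUnit
  have := congrArg P.toMonoid h
  simp only [map_mul] at this
  exact hγ.mul_right_cancel this

variable (P) in
/-- Every minimal word that represents a unit represents the unit of a factor of the relator. -/
lemma exists_val_eq {δ : List A} (hδ : IsMinimalUnit u [] δ) : ∃ i, word u [] δ = P.val i := by
  obtain ⟨z, hz⟩ := hδ.isUnit.exists_right_inv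
  obtain ⟨β, rfl⟩ := word_surjective z
  rw [← word_append, ← word_nil] at hz
  obtain ⟨L, hL, heq, -⟩ := Eval.of_word_eq hz.symm (eval_nil (P := P))
  have hmin : ∀ δ ∈ L.map Prod.fst, IsMinimalUnit u [] δ := by
    intro δ hδ
    obtain ⟨x, hx, rfl⟩ := List.mem_map.1 hδ
    exact (hL x hx).1
  obtain ⟨d₁, d₂, hd, hd₁, -⟩ := factorization_split hmin heq hδ.isUnit
  have : d₁ = [δ] := factorization_unique (fun x hx => hmin x (by simp [hd, hx]))
    (by simpa using hδ) (by simpa using hd₁)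
  have hmem : δ ∈ L.map Prod.fst := by simp [hd, this]
  obtain ⟨x, hx, rfl⟩ := List.mem_map.1 hmem
  exact ⟨x.2, (hL x hx).2⟩

end PieceLabels

lemma exists_pieceLabels (u : List A) : ∃ c : ℕ, Nonempty (PieceLabels u (Fin c)) := by
  obtain ⟨ds, hds, hflat⟩ : ∃ ds : List (List A), (∀ δ ∈ ds, IsMinimalUnit u [] δ) ∧
      ds.flatten = u := exists_factorization (by rw [word_rel]; exact isUnit_one)
  let C := {m : OneRelMonoid u [] // m ∈ ds.map (word u [])}
  have : Finite C := List.finite_toSet _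
  let e : C ≃ Fin (Nat.card C) := Finite.equivFin C
  let f : {δ // δ ∈ ds} → List A × Fin (Nat.card C) := fun δ =>
    (δ.1, e ⟨word u [] δ.1, List.mem_map_of_mem δ.2⟩)
  refine ⟨Nat.card C, ⟨⟨fun i => (e.symm i).1, Subtype.val_injective.comp e.symm.injective,
    ds.attach.map f, ?_, ?_, ?_, ?_⟩⟩⟩
  · intro x hx
    obtain ⟨δ, -, rfl⟩ := List.mem_map.1 hx
    exact hds δ.1 δ.2
  · intro x hx
    obtain ⟨δ, -, rfl⟩ := List.mem_map.1 hx
    simp [f]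
  · rw [List.map_map]
    change (ds.attach.map Subtype.val).flatten = u
    rw [List.attach_map_subtype_val, hflat]
  · intro i
    obtain ⟨δ, hδ, hi⟩ := List.mem_map.1 (e.symm i).2
    refine ⟨f ⟨δ, hδ⟩, List.mem_map_of_mem (List.mem_attach _ _), ?_⟩
    simp [f, hi]

end special

/-! ### Normal forms in a special one-relation monoid -/

section rewriting

variable {n : ℕ}

/-- The number with digits `a + 1` in base `n + 1`, for the letters `a` of a word. As no digit is `0`,
this is an injective measure of words that is monotone in the length (`num_injective`,
`num_lt_num_of_length_lt`), and the order it defines is compatible with contexts. -/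
def num (w : List (Fin n)) : ℕ := w.foldl (fun k (a : Fin n) => k * (n + 1) + (a.val + 1)) 0

lemma num_append_singleton (w : List (Fin n)) (a : Fin n) :
    num (w ++ [a]) = num w * (n + 1) + (a + 1) := by simp [num]

lemma num_append (x y : List (Fin n)) : num (x ++ y) = num x * (n + 1) ^ y.length + num y := by
  induction y using List.reverseRecOn with
  | nil => simp [num]
  | append_singleton y a ih =>
    rw [← List.append_assoc, num_append_singleton, num_append_singleton, ih, List.length_append,
      List.length_singleton, pow_succ]
    ring

lemma num_lt (w : List (Fin n)) : num w < (n + 1) ^ w.length := by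
  induction w using List.reverseRecOn with
  | nil => simp [num]
  | append_singleton w a ih =>
    rw [num_append_singleton, List.length_append, List.length_singleton, pow_succ]
    have := a.2
    nlinarith

lemma num_injective : Function.Injective (num (n := n)) := by
  intro w
  induction w using List.reverseRecOn with
  | nil =>
    intro w' h
    rcases List.eq_nil_or_concat' w' with rfl | ⟨w', b, rfl⟩
    · rfl
    · rw [num_append_singleton] at h
      simp [num] at h
  | append_singleton w a ih =>
    intro w' h
    rcases List.eq_nil_or_concat' w' with rfl | ⟨w', b, rfl⟩
    · rw [num_append_singleton] at h
      simp [num] at h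
    · rw [num_append_singleton, num_append_singleton] at h
      have ha : (a : ℕ) + 1 < n + 1 := by have := a.2; omega
      have hb : (b : ℕ) + 1 < n + 1 := by have := b.2; omega
      have h₁ : (a : ℕ) + 1 = b + 1 := by
        have := congrArg (· % (n + 1)) h
        simpa only [Nat.mul_add_mod', Nat.mod_eq_of_lt ha, Nat.mod_eq_of_lt hb] using this
      rw [h₁] at h
      rw [ih (Nat.eq_of_mul_eq_mul_right (Nat.succ_pos n) (Nat.add_right_cancel h)),
        Fin.ext (Nat.add_right_cancel h₁)]

lemma num_lt_num_of_length_lt {s t : List (Fin n)} (h : t.length < s.length) : num t < num s := by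
  rcases s with _ | ⟨a, s⟩
  · simp at h
  · have h₁ := num_lt t
    have h₂ : (n + 1) ^ t.length ≤ (n + 1) ^ s.length :=
      Nat.pow_le_pow_right (Nat.succ_pos n) (by simpa [Nat.lt_succ_iff] using h)
    have h₃ := num_append [a] s
    have h₄ : num [a] = a + 1 := by simp [num]
    rw [List.singleton_append, h₄] at h₃
    nlinarith

lemma length_le_of_num_lt_num {s t : List (Fin n)} (h : num t < num s) : t.length ≤ s.length :=
  not_lt.1 fun hl => (num_lt_num_of_length_lt hl).not_gt h

lemma num_context_lt {s t : List (Fin n)} (h : num t < num s) (x y : List (Fin n)) :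
    num (x ++ t ++ y) < num (x ++ s ++ y) := by
  have hx : num (x ++ t) < num (x ++ s) := by
    rcases (length_le_of_num_lt_num h).lt_or_eq with hl | hl
    · exact num_lt_num_of_length_lt (by simpa using hl)
    · rw [num_append, num_append, hl]
      omega
  rw [num_append, num_append _ y]
  have := Nat.mul_lt_mul_of_pos_right hx (Nat.pow_pos (Nat.succ_pos n) : 0 < (n + 1) ^ y.length)
  omega

variable {u : List (Fin n)}

variable (u) in
/-- Products of minimal words that represent units and are at most as long as the relator. -/
def IsShortProduct (s : List (Fin n)) : Prop :=
  ∃ ds : List (List (Fin n)),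
    (∀ δ ∈ ds, IsMinimalUnit u [] δ ∧ δ.length ≤ u.length) ∧ ds.flatten = s

lemma IsShortProduct.isUnit {s : List (Fin n)} (h : IsShortProduct u s) :
    IsUnit (word u [] s) := by
  obtain ⟨ds, hds, rfl⟩ := h
  exact isUnit_word_flatten fun δ hδ => (hds δ hδ).1

lemma IsShortProduct.nil : IsShortProduct u [] := ⟨[], by simp⟩

lemma IsShortProduct.append {s t : List (Fin n)} (hs : IsShortProduct u s)
    (ht : IsShortProduct u t) : IsShortProduct u (s ++ t) := by
  obtain ⟨ds, hds, rfl⟩ := hs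
  obtain ⟨dt, hdt, rfl⟩ := ht
  exact ⟨ds ++ dt, fun δ hδ => (List.mem_append.1 hδ).elim (hds δ) (hdt δ), by simp⟩

lemma isShortProduct_relator (u : List (Fin n)) : IsShortProduct u u := by
  obtain ⟨ds, hds, hflat⟩ := exists_factorization (u := u) (v := []) (w := u)
    (by rw [word_rel]; exact isUnit_one)
  refine ⟨ds, fun δ hδ => ⟨hds δ hδ, ?_⟩, hflat⟩
  have := (List.sublist_flatten_of_mem hδ).length_le
  rwa [hflat] at this

lemma IsShortProduct.split {s r : List (Fin n)} (h : IsShortProduct u (s ++ r))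
    (hs : IsUnit (word u [] s)) : IsShortProduct u s ∧ IsShortProduct u r := by
  obtain ⟨ds, hds, heq⟩ := h
  obtain ⟨d₁, d₂, rfl, rfl, rfl⟩ := factorization_split (fun δ hδ => (hds δ hδ).1) heq hs
  exact ⟨⟨d₁, fun δ hδ => hds δ (by simp [hδ]), rfl⟩, ⟨d₂, fun δ hδ => hds δ (by simp [hδ]), rfl⟩⟩

lemma IsShortProduct.replace {p s t r : List (Fin n)} (h : IsShortProduct u (p ++ s ++ r))
    (hs : IsShortProduct u s) (ht : IsShortProduct u t) (hst : word u [] s = word u [] t)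
    (hlen : t.length ≤ s.length) : IsShortProduct u (p ++ t ++ r) := by
  obtain ⟨ds, hds, heq⟩ := h
  rcases factorization_factor (fun δ hδ => (hds δ hδ).1) heq hs.isUnit with
    ⟨d₁, d₂, d₃, rfl, rfl, rfl, rfl⟩ | ⟨d₁, p', r', d₃, rfl, rfl, rfl, hp', hr'⟩
  · exact (IsShortProduct.append ⟨d₁, fun δ hδ => hds δ (by simp [hδ]), rfl⟩ ht).append
      ⟨d₃, fun δ hδ => hds δ (by simp [hδ]), rfl⟩
  · have hδ := hds (p' ++ s ++ r') (by simp)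
    refine ⟨d₁ ++ [p' ++ t ++ r'] ++ d₃, ?_, by simp⟩
    intro x hx
    simp only [List.mem_append, List.mem_singleton] at hx
    rcases hx with (hx | rfl) | hx
    · exact hds x (by simp [hx])
    · refine ⟨hδ.1.replace hp' hr' hs.isUnit hst, ?_⟩
      have := hδ.2
      simp only [List.length_append] at this ⊢
      omega
    · exact hds x (by simp [hx])

variable (u) in
/-- One step of a rewriting system for `Mon⟨A | u = 1⟩`: a short product is replaced by an equal
one with smaller `num`. -/
inductive Rewrites : List (Fin n) → List (Fin n) → Prop
  | mk (x : List (Fin n)) {s t : List (Fin n)} (y : List (Fin n)) (hs : IsShortProduct u s)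
      (ht : IsShortProduct u t) (hst : word u [] s = word u [] t) (hlt : num t < num s) :
      Rewrites (x ++ s ++ y) (x ++ t ++ y)

open Relation

lemma Rewrites.num_lt {w w' : List (Fin n)} (h : Rewrites u w w') : num w' < num w := by
  obtain ⟨x, y, _, _, _, h⟩ := h
  exact num_context_lt h x y

lemma Rewrites.word_eq {w w' : List (Fin n)} (h : Rewrites u w w') :
    word u [] w = word u [] w' := by
  obtain ⟨x, y, _, _, h, _⟩ := h
  simp only [word_append, h]

lemma join_of_isShortProduct (x : List (Fin n)) {s t : List (Fin n)} (y : List (Fin n))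
    (hs : IsShortProduct u s) (ht : IsShortProduct u t) (hst : word u [] s = word u [] t) :
    Join (ReflTransGen (Rewrites u)) (x ++ s ++ y) (x ++ t ++ y) := by
  rcases lt_trichotomy (num s) (num t) with h | h | h
  · exact ⟨_, .refl, .single (.mk x y ht hs hst.symm h)⟩
  · rw [num_injective h]
    exact ⟨_, .refl, .refl⟩
  · exact ⟨_, .single (.mk x y hs ht hst h), .refl⟩

/-- Two rewriting steps, the first of which acts further to the left, can be joined. -/
lemma join_of_rewrites_aux {x₁ s₁ t₁ y₁ a s₂ t₂ y₂ : List (Fin n)}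
    (heq : s₁ ++ y₁ = a ++ (s₂ ++ y₂)) (hs₁ : IsShortProduct u s₁) (ht₁ : IsShortProduct u t₁)
    (h₁ : word u [] s₁ = word u [] t₁) (hlt₁ : num t₁ < num s₁) (hs₂ : IsShortProduct u s₂)
    (ht₂ : IsShortProduct u t₂) (h₂ : word u [] s₂ = word u [] t₂) (hlt₂ : num t₂ < num s₂) :
    Join (ReflTransGen (Rewrites u)) (x₁ ++ t₁ ++ y₁) (x₁ ++ a ++ t₂ ++ y₂) := by
  rw [List.append_eq_append_iff] at heq
  rcases heq with ⟨b, rfl, rfl⟩ | ⟨b, rfl, heq⟩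
  · -- disjoint factors
    refine ⟨x₁ ++ t₁ ++ b ++ t₂ ++ y₂, .single ?_, .single ?_⟩
    · simpa using Rewrites.mk (x₁ ++ t₁ ++ b) y₂ hs₂ ht₂ h₂ hlt₂
    · simpa using Rewrites.mk x₁ (b ++ t₂ ++ y₂) hs₁ ht₁ h₁ hlt₁
  rw [List.append_eq_append_iff] at heq
  rcases heq with ⟨c, rfl, rfl⟩ | ⟨c, rfl, rfl⟩
  · -- the second factor lies inside the first
    have hr : IsShortProduct u (a ++ t₂ ++ c) :=
      IsShortProduct.replace (by simpa using hs₁) hs₂ ht₂ h₂ (length_le_of_num_lt_num hlt₂)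
    have := join_of_isShortProduct x₁ y₁ ht₁ hr
      (by rw [← h₁]; simp only [word_append, h₂, mul_assoc])
    simpa using this
  · -- a proper overlap `b`, which is itself a short product
    have hb : IsUnit (word u [] b) := isUnit_of_isUnit_mul_of_isUnit_mul
      (by simpa only [word_append] using hs₁.isUnit) (by simpa only [word_append] using hs₂.isUnit)
    have ha : IsUnit (word u [] a) := by
      have := hs₁.isUnit
      rwa [word_append, isUnit_mul_iff_left hb] at this
    have := join_of_isShortProduct x₁ y₂ (ht₁.append (hs₂.split hb).2)
      ((hs₁.split ha).1.append ht₂) (by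
        rw [word_append, word_append, ← h₁, ← h₂]
        simp only [word_append, mul_assoc])
    simpa using this

lemma join_of_rewrites {w w₁ w₂ : List (Fin n)} (h₁ : Rewrites u w w₁) (h₂ : Rewrites u w w₂) :
    Join (ReflTransGen (Rewrites u)) w₁ w₂ := by
  generalize hw : w = w' at h₁
  obtain ⟨x₁, y₁, hs₁, ht₁, he₁, hlt₁⟩ := h₁
  obtain ⟨x₂, y₂, hs₂, ht₂, he₂, hlt₂⟩ := h₂
  rw [List.append_assoc, List.append_assoc, List.append_eq_append_iff] at hw
  rcases hw with ⟨a, rfl, heq⟩ | ⟨a, rfl, heq⟩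
  · obtain ⟨c, hc₁, hc₂⟩ := join_of_rewrites_aux (x₁ := x₂) heq hs₂ ht₂ he₂ hlt₂ hs₁ ht₁ he₁ hlt₁
    exact ⟨c, hc₂, hc₁⟩
  · exact join_of_rewrites_aux heq hs₁ ht₁ he₁ hlt₁ hs₂ ht₂ he₂ hlt₂

variable (u) in
/-- Words to which no rewriting step applies. -/
def IsNormal (w : List (Fin n)) : Prop := ∀ w', ¬ Rewrites u w w'

lemma exists_isNormal (w : List (Fin n)) : ∃ w', ReflTransGen (Rewrites u) w w' ∧ IsNormal u w' := by
  induction hk : num w using Nat.strong_induction_on generalizing w with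
  | _ k ih =>
    subst hk
    by_cases h : IsNormal u w
    · exact ⟨w, .refl, h⟩
    · simp only [IsNormal, not_forall, not_not] at h
      obtain ⟨w₁, h₁⟩ := h
      obtain ⟨w', h', hn⟩ := ih _ h₁.num_lt w₁ rfl
      exact ⟨w', h'.head h₁, hn⟩

lemma IsNormal.eq_of_rewrites {w w' : List (Fin n)} (hw : IsNormal u w)
    (h : ReflTransGen (Rewrites u) w w') : w = w' := by
  rcases h.cases_head with rfl | ⟨_, h, -⟩
  · rfl
  · exact absurd h (hw _)

/-- Normal forms are unique, by local confluence and termination. -/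
lemma isNormal_unique {w w₁ w₂ : List (Fin n)} (h₁ : ReflTransGen (Rewrites u) w w₁)
    (h₂ : ReflTransGen (Rewrites u) w w₂) (hn₁ : IsNormal u w₁) (hn₂ : IsNormal u w₂) :
    w₁ = w₂ := by
  induction hk : num w using Nat.strong_induction_on generalizing w w₁ w₂ with
  | _ k ih =>
    subst hk
    rcases h₁.cases_head with rfl | ⟨z₁, hz₁, h₁⟩
    · exact hn₁.eq_of_rewrites h₂
    rcases h₂.cases_head with rfl | ⟨z₂, hz₂, h₂⟩
    · exact absurd hz₁ (hn₂ _)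
    obtain ⟨c, hc₁, hc₂⟩ := join_of_rewrites hz₁ hz₂
    obtain ⟨m, hm, hnm⟩ := exists_isNormal (u := u) c
    rw [ih _ hz₁.num_lt h₁ (hc₁.trans hm) hn₁ hnm rfl,
      ih _ hz₂.num_lt h₂ (hc₂.trans hm) hn₂ hnm rfl]

lemma rewrites_relator (hu : u ≠ []) (x y : List (Fin n)) :
    Rewrites u (x ++ u ++ y) (x ++ y) := by
  simpa using Rewrites.mk x y (isShortProduct_relator u) .nil word_rel
    (num_lt_num_of_length_lt (by simpa [List.length_pos_iff] using hu))

lemma IsNormal.eq_of_word_eq (hu : u ≠ []) {w w' : List (Fin n)} (hw : IsNormal u w)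
    (hw' : IsNormal u w') (h : word u [] w = word u [] w') : w = w' := by
  have key := word_induction
    (P := fun z => ∀ z', IsNormal u z' → ReflTransGen (Rewrites u) z z' → z' = w)
    (fun x y hxy z' hz' h => hxy z' hz' (by simpa using (ReflTransGen.head
      (rewrites_relator hu x y) (by simpa using h))))
    (fun x y hxy z' hz' h => by
      rw [List.append_nil] at hxy
      obtain ⟨m, hm, hnm⟩ := exists_isNormal (u := u) (x ++ y)
      rw [← hxy m hnm hm]
      exact isNormal_unique h (hm.head (rewrites_relator hu x y)) hz' hnm)
    h (fun z' _ hz => (hw.eq_of_rewrites hz).symm)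
  exact (key w' hw' .refl).symm

end rewriting

/-! ### Decidability of the word problem of special monoids -/

lemma computablePred_forall_mem {α β : Type*} [Primcodable α] [Primcodable β]
    {p : α × β → Prop} {L : α → List β} (hp : ComputablePred p) (hL : Computable L) :
    ComputablePred fun a => ∀ b ∈ L a, p (a, b) := by
  classical
  let f : α → ℕ → Bool := fun a k => Nat.rec true
    (fun i acc => acc && ((L a)[i]?).elim true fun b => decide (p (a, b))) k
  have hf : Computable fun a => f a (L a).length := by
    refine Computable.nat_rec (Computable.list_length.comp hL) (Computable.const true)
      (h := fun a (q : ℕ × Bool) => q.2 && ((L a)[q.1]?).elim true fun b => decide (p (a, b))) ?_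
    refine Primrec.and.to_comp.comp (Computable.snd.comp Computable.snd) ?_
    have hget : Computable fun q : α × (ℕ × Bool) => (L q.1)[q.2.1]? :=
      Computable.list_getElem?.comp (hL.comp Computable.fst) (Computable.fst.comp Computable.snd)
    refine (Computable.option_casesOn hget (Computable.const true)
      (g := fun q b => decide (p (q.1, b))) (hp.decide.comp
        ((Computable.fst.comp Computable.fst).pair Computable.snd)).to₂).of_eq fun q => ?_
    cases (L q.1)[q.2.1]? <;> rfl
  have hfk : ∀ a k, f a k = true ↔ ∀ i < k, ∀ b, (L a)[i]? = some b → p (a, b) := by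
    intro a k
    induction k with
    | zero => simp [f]
    | succ k ih =>
      have : f a (k + 1) = (f a k && ((L a)[k]?).elim true fun b => decide (p (a, b))) := rfl
      rw [this, Bool.and_eq_true, ih]
      constructor
      · rintro ⟨h₁, h₂⟩ i hi b hb
        rcases Nat.lt_succ_iff_lt_or_eq.1 hi with hi | rfl
        · exact h₁ i hi b hb
        · simpa [hb] using h₂
      · intro h
        refine ⟨fun i hi => h i (by omega), ?_⟩
        rcases hb : (L a)[k]? with _ | b
        · rfl
        · simpa using h k (by omega) b hb
  refine ⟨fun a => inferInstance, hf.of_eq fun a => ?_⟩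
  rw [Bool.eq_iff_iff, hfk, decide_eq_true_iff]
  constructor
  · intro h b hb
    obtain ⟨i, hi⟩ := List.mem_iff_getElem?.1 hb
    have : i < (L a).length := (List.getElem?_eq_some_iff.1 hi).1
    exact h i this b hi
  · intro h i _ b hb
    exact h b (List.mem_iff_getElem?.2 ⟨i, hb⟩)

/-- A list of words that contains all words of length at most `k` over `Fin d`. -/
def shortWords (d k : ℕ) : List (List (Fin d)) :=
  Nat.rec [[]] (fun _ l => [] :: l.flatMap fun w => (List.finRange d).map (· :: w)) k

lemma mem_shortWords {d k : ℕ} {w : List (Fin d)} (h : w.length ≤ k) : w ∈ shortWords d k := by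
  induction k generalizing w with
  | zero =>
    obtain rfl : w = [] := List.length_eq_zero_iff.1 (by omega)
    exact List.mem_singleton.2 rfl
  | succ k ih =>
    change w ∈ [] :: (shortWords d k).flatMap fun w => (List.finRange d).map (· :: w)
    rcases w with _ | ⟨a, w⟩
    · simp
    · simpa using ih (by simpa using h)

lemma primrec_shortWords (d : ℕ) : Primrec (shortWords d) := by
  refine Primrec.nat_rec₁ _ (f := fun _ l => [] :: l.flatMap fun w =>
    (List.finRange d).map (· :: w)) ?_
  refine Primrec.list_cons.comp (Primrec.const []) (Primrec.list_flatMap Primrec.snd ?_)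
  exact Primrec.list_map (Primrec.const _)
    (Primrec.list_cons.comp Primrec.snd (Primrec.snd.comp Primrec.fst)).to₂

section decide

variable {n : ℕ}

lemma primrec_num : Primrec (num (n := n)) :=
  (Primrec.list_foldl (h := fun _ (q : ℕ × Fin n) => q.1 * (n + 1) + (q.2.val + 1)) Primrec.id
    (Primrec.const 0) (Primrec.nat_add.comp (Primrec.nat_mul.comp (Primrec.fst.comp Primrec.snd)
      (Primrec.const _)) (Primrec.succ.comp
        (Primrec.fin_val.comp (Primrec.snd.comp Primrec.snd)))).to₂).of_eq fun _ => rfl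

/-- Inserting or deleting the relator at the place given by a pair of contexts. -/
def applyRelator (u w : List (Fin n)) (p : List (Fin n) × List (Fin n)) : List (Fin n) :=
  if w = p.1 ++ p.2 then p.1 ++ u ++ p.2 else if w = p.1 ++ u ++ p.2 then p.1 ++ p.2 else w

/-- The result of a sequence of insertions and deletions of the relator. -/
def runDerivation (u w : List (Fin n)) (d : List (List (Fin n) × List (Fin n))) : List (Fin n) :=
  d.foldl (applyRelator u) w

lemma primrec_runDerivation (u : List (Fin n)) : Primrec₂ (runDerivation u) := by
  refine Primrec.list_foldl (h := fun _ q => applyRelator u q.1 q.2) Primrec.snd Primrec.fst ?_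
  let α := (List (Fin n) × List (List (Fin n) × List (Fin n))) ×
    (List (Fin n) × (List (Fin n) × List (Fin n)))
  have hw : Primrec fun q : α => q.2.1 := Primrec.fst.comp Primrec.snd
  have hx : Primrec fun q : α => q.2.2.1 := Primrec.fst.comp (Primrec.snd.comp Primrec.snd)
  have hy : Primrec fun q : α => q.2.2.2 := Primrec.snd.comp (Primrec.snd.comp Primrec.snd)
  have hxy := Primrec.list_append.comp hx hy
  have hxuy := Primrec.list_append.comp (Primrec.list_append.comp hx (Primrec.const u)) hy
  exact Primrec.ite (PrimrecRel.comp Primrec.eq hw hxy) hxuy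
    (Primrec.ite (PrimrecRel.comp Primrec.eq hw hxuy) hxy hw)

lemma word_runDerivation (u w : List (Fin n)) (d : List (List (Fin n) × List (Fin n))) :
    word u [] (runDerivation u w d) = word u [] w := by
  induction d generalizing w with
  | nil => rfl
  | cons p d ih =>
    refine (ih _).trans ?_
    unfold applyRelator
    split_ifs with h₁ h₂
    · rw [h₁]; simp [word_append, word_rel (u := u)]
    · rw [h₂]; simp [word_append, word_rel (u := u)]
    · rfl

lemma exists_runDerivation {u w w' : List (Fin n)} (hu : u ≠ []) (h : word u [] w = word u [] w') :
    ∃ d, runDerivation u w d = w' := by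
  refine word_induction (P := fun z => ∃ d, runDerivation u w d = z) ?_ ?_ h ⟨[], rfl⟩
  · rintro x y ⟨d, hd⟩
    refine ⟨d ++ [(x, y)], ?_⟩
    rw [runDerivation, List.foldl_append]
    change applyRelator u (runDerivation u w d) (x, y) = _
    rw [hd]
    simp [applyRelator, hu]
  · rintro x y ⟨d, hd⟩
    refine ⟨d ++ [(x, y)], ?_⟩
    rw [runDerivation, List.foldl_append]
    change applyRelator u (runDerivation u w d) (x, y) = _
    rw [hd]
    simp [applyRelator]

/-- Being in normal form is decidable if the word problem of the monoid of units is. -/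
lemma computablePred_isNormal {u : List (Fin n)} {c : ℕ} (P : PieceLabels u (Fin c))
    (hP : WordProblemDecidable (MonRel P.relator [])) : ComputablePred (IsNormal u) := by
  have hfin : Finite {δ : List (Fin n) // IsMinimalUnit u [] δ ∧ δ.length ≤ u.length} :=
    Set.Finite.subset (List.finite_length_le (Fin n) u.length) fun δ hδ => hδ.2
  let d := Nat.card {δ : List (Fin n) // IsMinimalUnit u [] δ ∧ δ.length ≤ u.length}
  let e : {δ : List (Fin n) // IsMinimalUnit u [] δ ∧ δ.length ≤ u.length} ≃ Fin d :=
    Finite.equivFin _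
  let enc : Fin d → List (Fin n) := fun i => (e.symm i).1
  have henc : ∀ i, IsMinimalUnit u [] (enc i) ∧ (enc i).length ≤ u.length := fun i => (e.symm i).2
  choose cls hcls using fun i => P.exists_val_eq (henc i).1
  -- A short product is spelled by a word `σ` over the indices of its factors; its value is
  -- determined by the labels of these factors.
  have hword : ∀ σ : List (Fin d), word u [] (σ.flatMap enc) =
      P.toMonoid (word P.relator [] (σ.map cls)) := by
    intro σ
    induction σ with
    | nil => simp
    | cons i σ ih =>
      rw [List.flatMap_cons, word_append, ih, hcls, List.map_cons, word_cons (cls i), map_mul]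
      simp [PieceLabels.toMonoid_word]
  have hshort : ∀ σ : List (Fin d), IsShortProduct u (σ.flatMap enc) := fun σ =>
    ⟨σ.map enc, by
      intro δ hδ
      obtain ⟨i, -, rfl⟩ := List.mem_map.1 hδ
      exact henc i, by rw [List.flatMap_def]⟩
  have hspell : ∀ s, IsShortProduct u s → ∃ σ : List (Fin d), σ.flatMap enc = s := by
    rintro _ ⟨ds, hds, rfl⟩
    refine ⟨ds.pmap (fun δ hδ => e ⟨δ, hδ⟩) hds, ?_⟩
    rw [List.flatMap_def, List.map_pmap]
    simp [enc]
  have hlen : ∀ σ : List (Fin d), σ.length ≤ (σ.flatMap enc).length := by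
    intro σ
    induction σ with
    | nil => simp
    | cons i σ ih =>
      have := List.length_pos_iff.2 (henc i).1.ne_nil
      rw [List.flatMap_cons, List.length_append, List.length_cons]
      omega
  let β := ((List (Fin n) × ℕ) × List (Fin d)) × List (Fin d)
  have henc' : Primrec fun σ : List (Fin d) => σ.flatMap enc :=
    Primrec.list_flatMap Primrec.id ((Primrec.dom_finite enc).comp Primrec.snd).to₂
  have hw : Primrec fun q : β => q.1.1.1 := Primrec.fst.comp (Primrec.fst.comp Primrec.fst)
  have hi : Primrec fun q : β => q.1.1.2 := Primrec.snd.comp (Primrec.fst.comp Primrec.fst)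
  have hσ : Primrec fun q : β => q.1.2 := Primrec.snd.comp Primrec.fst
  have hτ : Primrec fun q : β => q.2 := Primrec.snd
  have hcls' : Primrec fun σ : List (Fin d) => σ.map cls :=
    Primrec.list_map Primrec.id ((Primrec.dom_finite cls).comp Primrec.snd).to₂
  have h₁ : ComputablePred fun q : β =>
      (q.1.1.1.drop q.1.1.2).take (q.1.2.flatMap enc).length = q.1.2.flatMap enc :=
    PrimrecPred.computablePred (PrimrecRel.comp Primrec.eq
      (Primrec.list_take.comp (Primrec.list_length.comp (henc'.comp hσ))
        (Primrec.list_drop.comp hi hw)) (henc'.comp hσ))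
  have h₂ : ComputablePred fun q : β => num (q.2.flatMap enc) < num (q.1.2.flatMap enc) :=
    PrimrecPred.computablePred (PrimrecRel.comp Primrec.nat_lt
      (primrec_num.comp (henc'.comp hτ)) (primrec_num.comp (henc'.comp hσ)))
  have h₃ : ComputablePred fun q : β =>
      word P.relator [] (q.1.2.map cls) = word P.relator [] (q.2.map cls) :=
    computablePred_comp (f := fun q : β => (q.1.2.map cls, q.2.map cls)) hP
      (Primrec.pair (hcls'.comp hσ) (hcls'.comp hτ)).to_comp
  have hall := computablePred_forall_mem (L := fun w : List (Fin n) => List.range (w.length + 1))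
    (computablePred_forall_mem
      (L := fun q : List (Fin n) × ℕ => shortWords d q.1.length)
      (computablePred_forall_mem
        (L := fun q : (List (Fin n) × ℕ) × List (Fin d) => shortWords d q.1.1.length)
        (computablePred_and h₁ (computablePred_and h₂ h₃)).not
        ((primrec_shortWords d).comp (Primrec.list_length.comp
          (Primrec.fst.comp Primrec.fst))).to_comp)
      ((primrec_shortWords d).comp (Primrec.list_length.comp Primrec.fst)).to_comp)
    (Primrec.list_range.comp (Primrec.succ.comp Primrec.list_length)).to_comp
  refine hall.of_eq fun w => ⟨fun h w' hw' => ?_, fun h i _ σ _ τ _ hcon => ?_⟩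
  · obtain ⟨x, y, hs, ht, hst, hlt⟩ := hw'
    obtain ⟨σ, rfl⟩ := hspell _ hs
    obtain ⟨τ, rfl⟩ := hspell _ ht
    have hσl := hlen σ
    have hτl := hlen τ
    have hle := length_le_of_num_lt_num hlt
    refine h x.length (List.mem_range.2 (by simp only [List.length_append]; omega))
      σ (mem_shortWords (by simp only [List.length_append]; omega))
      τ (mem_shortWords (by simp only [List.length_append]; omega)) ⟨?_, hlt, ?_⟩
    · simp
    · rw [hword, hword] at hst
      exact PieceLabels.toMonoid_injective hst
  · obtain ⟨hocc, hlt, hst⟩ := hcon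
    have hwd : w = w.take i ++ σ.flatMap enc ++
        (w.drop i).drop (σ.flatMap enc).length := by
      conv_lhs => rw [← List.take_append_drop i w,
        ← List.take_append_drop (σ.flatMap enc).length (w.drop i), hocc]
      rw [List.append_assoc]
    have hstep := Rewrites.mk (u := u) (w.take i) ((w.drop i).drop (σ.flatMap enc).length)
      (hshort σ) (hshort τ) (by rw [hword, hword, hst]) hlt
    rw [← hwd] at hstep
    exact h _ hstep

/-- The word problem of a special one-relation monoid `Mon⟨A | u = 1⟩` reduces to the word problems
of right cancellative special one-relation monoids: a normal form is found by search. -/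
lemma wordProblemDecidable_special
    (H : ∀ (c : ℕ) (r : List (Fin c)), IsRightCancelMul (OneRelMonoid r []) →
      WordProblemDecidable (MonRel r [])) {u : List (Fin n)} (hu : u ≠ []) :
    WordProblemDecidable (MonRel u []) := by
  classical
  obtain ⟨c, ⟨P⟩⟩ := exists_pieceLabels u
  have hN := computablePred_isNormal P (H c _ P.isRightCancelMul)
  let run : List (Fin n) → ℕ → List (Fin n) := fun w k =>
    runDerivation u w ((Encodable.decode k).getD [])
  have hrun : Computable fun q : List (Fin n) × ℕ => run q.1 q.2 :=
    ((primrec_runDerivation u).comp Primrec.fst (Primrec.option_getD.comp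
      (Primrec.decode.comp Primrec.snd) (Primrec.const []))).to_comp
  have hex : ∀ w, ∃ k, IsNormal u (run w k) := by
    intro w
    obtain ⟨w', hw', hn⟩ := exists_isNormal (u := u) w
    have hww' : word u [] w = word u [] w' := by
      clear hn
      induction hw' with
      | refl => rfl
      | tail _ h ih => exact ih.trans h.word_eq
    obtain ⟨d, hd⟩ := exists_runDerivation hu hww'
    exact ⟨Encodable.encode d, by simpa [run, hd] using hn⟩
  have hfind := Computable.find (P := fun w k => IsNormal u (run w k))
    (computablePred_comp (f := fun q : List (Fin n) × ℕ => run q.1 q.2) hN hrun) hex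
  have hnf : Computable fun w => run w (Nat.find (hex w)) :=
    hrun.comp (Computable.id.pair hfind)
  refine (computablePred_comp (q := fun p : List (Fin n) × List (Fin n) => p.1 = p.2)
    (PrimrecPred.computablePred Primrec.eq)
    ((hnf.comp Computable.fst).pair (hnf.comp Computable.snd))).of_eq fun p => ?_
  change _ ↔ word u [] p.1 = word u [] p.2
  constructor
  · intro h
    rw [← word_runDerivation u p.1, ← word_runDerivation u p.2]
    exact congrArg (word u []) h
  · intro h
    refine IsNormal.eq_of_word_eq hu (Nat.find_spec (hex p.1)) (Nat.find_spec (hex p.2)) ?_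
    exact (word_runDerivation u p.1 _).trans (h.trans (word_runDerivation u p.2 _).symm)

end decide

/-! ### The word problem of all one-relation monoids -/

lemma exists_map_finVal (u v : List ℕ) :
    ∃ (N : ℕ) (u' v' : List (Fin N)), u'.map Fin.val = u ∧ v'.map Fin.val = v := by
  obtain ⟨N, hN⟩ := (u ++ v).toFinset.exists_nat_subset_range
  have h : ∀ a ∈ u ++ v, a < N := fun a ha =>
    Finset.mem_range.1 (hN (List.mem_toFinset.2 ha))
  refine ⟨N, u.pmap Fin.mk fun a ha => h a (by simp [ha]),
    v.pmap Fin.mk fun a ha => h a (by simp [ha]), ?_, ?_⟩ <;> simp [List.map_pmap]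

lemma wordProblemDecidable_of_invRel
    (H : ∀ (n : ℕ) (w : List (Fin n × Bool)), FreeGroup.IsReduced w →
      WordProblemDecidable (InvRel w)) (n : ℕ) (u v : List (Fin n)) :
    WordProblemDecidable (MonRel u v) := by
  have hunits : ∀ (c : ℕ) (r : List (Fin c)), IsRightCancelMul (OneRelMonoid r []) →
      WordProblemDecidable (MonRel r []) := fun c r _ =>
    wordProblemDecidable_of_isRightCancelMul r [] (H c _ (isReduced_quotientWord_nil r))
  refine wordProblemDecidable_fin_of_nat u v (wordProblemDecidable_nat ?_ ?_ _ _)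
  · intro u₀ v₀ a b hab
    obtain ⟨N, u', v', hu, hv⟩ := exists_map_finVal (u₀ ++ [a]) (v₀ ++ [b])
    obtain ⟨u₁, l, rfl, rfl, hl⟩ := List.map_eq_append_iff.1 hu
    obtain ⟨a', rfl, rfl⟩ := List.map_eq_singleton_iff.1 hl
    obtain ⟨v₁, l, rfl, rfl, hl⟩ := List.map_eq_append_iff.1 hv
    obtain ⟨b', rfl, rfl⟩ := List.map_eq_singleton_iff.1 hl
    rw [← hu, ← hv]
    refine wordProblemDecidable_nat_of_fin _ _ ?_
    have hab' : Fin.castAdd 2 a' ≠ Fin.castAdd 2 b' := fun h =>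
      hab (congrArg Fin.val (Fin.castAdd_injective N 2 h))
    rw [List.map_append, List.map_append, List.map_singleton, List.map_singleton]
    have := isRightCancelMul_of_last_ne (u₁.map (Fin.castAdd 2)) (v₁.map (Fin.castAdd 2)) hab'
    exact wordProblemDecidable_of_isRightCancelMul _ _
      (H _ _ (isReduced_quotientWord_of_last_ne _ _ hab'))
  · intro u
    by_cases hu : u = []
    · subst hu
      refine (PrimrecPred.computablePred (p := fun p : List ℕ × List ℕ => p.1 = p.2)
        Primrec.eq).of_eq fun p => ⟨fun h => by rw [h], fun h => ?_⟩
      exact word_induction (P := fun z => p.1 = z) (fun _ _ h => h) (fun _ _ h => h) h rfl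
    · obtain ⟨N, u', -, rfl, -⟩ := exists_map_finVal u []
      refine wordProblemDecidable_nat_of_fin u' [] (wordProblemDecidable_special hunits ?_)
      simpa using hu

end OneRel

theorem mainTheorem1 :
    ((∀ (n : ℕ) (w : List (Fin n × Bool)), FreeGroup.IsReduced w →
        WordProblemDecidable (InvRel w)) →
      ∀ (n : ℕ) (u v : List (Fin n)), WordProblemDecidable (MonRel u v)) ∧
    (∀ (n : ℕ) (p q : List (Fin n)), IsRightCancelMul (OneRelMonoid p q) →
      NaturallyEmbeds p q) ∧
    (∀ u v : List (Fin 2), IsRightCancelMul (OneRelMonoid ([0] ++ u ++ [1]) ([0] ++ v ++ [0])) ∧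
      NaturallyEmbeds ([0] ++ u ++ [1]) ([0] ++ v ++ [0])) ∧
    (∀ u : List (Fin 2), IsRightCancelMul (OneRelMonoid ([0] ++ u ++ [1]) [0]) ∧
      NaturallyEmbeds ([0] ++ u ++ [1]) [0]) := by
  refine ⟨OneRel.wordProblemDecidable_of_invRel,
    fun n p q _ => OneRel.naturallyEmbeds_of_isRightCancelMul p q, fun u v => ?_, fun u => ?_⟩
  · have := OneRel.isRightCancelMul_of_last_ne ([0] ++ u) ([0] ++ v) (a := (1 : Fin 2)) (b := 0)
      (by decide)
    exact ⟨this, OneRel.naturallyEmbeds_of_isRightCancelMul _ _⟩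
  · have : IsRightCancelMul (OneRelMonoid ([0] ++ u ++ [1]) [0]) :=
      OneRel.isRightCancelMul_of_last_ne ([0] ++ u) [] (a := (1 : Fin 2)) (b := 0) (by decide)
    exact ⟨this, OneRel.naturallyEmbeds_of_isRightCancelMul _ [0]⟩
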